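/- For each $\varepsilon > 0$ there exists a constant $C = C(\varepsilon) > 0$ such that the following holds. Let $p = p(n) \in [0,1]$ be any function satisfying $n^{-1}\log n \ll 1-p(n) \ll n^{-2/3}$ as $n \to \infty$ (where $f \ll g$ means $f = o(g)$). Then, for all sufficiently large $n$, $$\mathbb{P}\Big( \big| \chi(G(n,p)) - \mathbb{E}\big[\chi(G(n,p))\big] \big| \ge C\, n^{3/2} (1-p)^{3/2} \Big) \le \varepsilon,$$ where $\chi(G(n,p))$ is the chromatic number of the binomial random graph $G(n,p)$ on $n$ vertices, in which each pair of vertices is an edge independently with probability $p = p(n)$. -/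

import Mathlib

open Filter MeasureTheory

/-- The chromatic number of a graph on the vertex set `{0, …, n - 1}`, as a real number (it is at
most `n`, so that the conversion from extended natural numbers loses nothing). -/
noncomputable def chi {n : ℕ} (G : SimpleGraph (Fin n)) : ℝ :=
  (G.chromaticNumber.toNat : ℝ)

/-- The expectation of the chromatic number of the binomial random graph `G(n, p)`. -/
noncomputable def meanChi (n : ℕ) (p : unitInterval) : ℝ :=
  ∫ G, chi G ∂(SimpleGraph.binomialRandom (Fin n) p)

/-!
Let `q = 1 - p` and `d = n * q`, and let `H` be the complement of `G(n, p)`. A colouring of `G(n, p)`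
is a partition of the vertices into cliques of `H`. Since `q ≪ n ^ (-2 / 3)`, cliques of `H` with four
vertices are so rare that they do not matter, and a class of three vertices is a triangle. If `ν` is
the largest number of vertex-disjoint triangles of `H` (`packingNumber`), then the chromatic number
is at least `(n - ν) / 2` up to the number of cliques with four vertices
(`card_le_of_coloring_compl`). It is at most `(n - ν + 1) / 2` as soon as the vertices off a largest
packing of triangles have a perfect matching, up to one vertex.

Tutte's theorem provides this matching in every graph in which small sets expand and large sets are
joined (`exists_isPerfectMatching_of_expansion`). Outside the packing, small sets expand because
small sets span few edges of `H` and because every vertex keeps many neighbours off the packing. The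
packing depends on `H`, so the last point needs care: the set of vertices that lie on a triangle
avoiding `v` is determined by `H - v`, hence is independent of the neighbourhood of `v`, and it
typically has at most `n / 20` elements because `d ^ 3 ≪ n` (`bprob_not_few_spokes`). All this fails
with probability at most `1 / n` (`card_mul_bprob_not_isQuasirandom_le_one`), so the chromatic number
differs from `(n - ν) / 2` by `O(1)` in mean.

The packing number is monotone, changes by at most one when an edge is deleted, and is certified by
the `3 * ν` edges of a packing. By the Efron–Stein inequality (`efron_stein`) its variance is at most
`3 * 𝔼 ν ≤ 3 * d ^ 3`. The mean absolute deviation of the chromatic number is therefore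
`O(d ^ (3 / 2))` (`integral_abs_chi_sub_le`), and Markov's inequality concludes.

Random graphs are handled as random sets of pairs, with expectations `bexp` that are finite sums;
`integral_binomialRandom` is the translation.
-/

open Finset

/-! ### Expectations over a random subset of a finite set -/

section RandomSubset

variable {α : Type*} [DecidableEq α]

/-- The expectation of `f A` when `A` is the random subset of `s` that contains each element of `s`
independently with probability `q`. -/
noncomputable def bexp (q : ℝ) (s : Finset α) (f : Finset α → ℝ) : ℝ :=
  ∑ A ∈ s.powerset, q ^ #A * (1 - q) ^ #(s \ A) * f A

open Classical in
/-- The probability that the random subset `A` of `s` satisfies `P`. -/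
noncomputable def bprob (q : ℝ) (s : Finset α) (P : Finset α → Prop) : ℝ :=
  bexp q s fun A ↦ if P A then 1 else 0

variable {q : ℝ} {s t : Finset α} {f g : Finset α → ℝ} {P Q : Finset α → Prop}

theorem bexp_empty : bexp q ∅ f = f ∅ := by simp [bexp]

theorem bexp_insert {a : α} (ha : a ∉ s) :
    bexp q (insert a s) f = (1 - q) * bexp q s f + q * bexp q s (fun A ↦ f (insert a A)) := by
  unfold bexp
  rw [sum_powerset_insert ha, mul_sum, mul_sum]
  congr 1
  · refine sum_congr rfl fun A hA ↦ ?_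
    have hA' : a ∉ A := fun h ↦ ha (mem_powerset.1 hA h)
    rw [insert_sdiff_of_notMem _ hA', card_insert_of_notMem (by simp [ha])]
    ring
  · refine sum_congr rfl fun A hA ↦ ?_
    have hA' : a ∉ A := fun h ↦ ha (mem_powerset.1 hA h)
    rw [card_insert_of_notMem hA', insert_sdiff_insert, sdiff_insert_of_notMem ha]
    ring

theorem bexp_congr (h : ∀ A ⊆ s, f A = g A) : bexp q s f = bexp q s g :=
  sum_congr rfl fun A hA ↦ by rw [h A (mem_powerset.1 hA)]

theorem bexp_add : bexp q s (fun A ↦ f A + g A) = bexp q s f + bexp q s g := by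
  simp only [bexp, mul_add, sum_add_distrib]

theorem bexp_const_mul (c : ℝ) : bexp q s (fun A ↦ c * f A) = c * bexp q s f := by
  simp only [bexp, mul_sum]
  exact sum_congr rfl fun A _ ↦ by ring

theorem bexp_sub : bexp q s (fun A ↦ f A - g A) = bexp q s f - bexp q s g := by
  simp only [bexp, mul_sub, sum_sub_distrib]

theorem bexp_sum {ι : Type*} (I : Finset ι) (F : ι → Finset α → ℝ) :
    bexp q s (fun A ↦ ∑ i ∈ I, F i A) = ∑ i ∈ I, bexp q s (F i) := by
  simp only [bexp, mul_sum]
  exact sum_comm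

theorem bexp_const (c : ℝ) : bexp q s (fun _ ↦ c) = c := by
  induction s using Finset.induction_on with
  | empty => exact bexp_empty
  | insert a s ha ih => rw [bexp_insert ha, ih]; ring

theorem bexp_mono (h0 : 0 ≤ q) (h1 : q ≤ 1) (h : ∀ A ⊆ s, f A ≤ g A) :
    bexp q s f ≤ bexp q s g := by
  have h2 : 0 ≤ 1 - q := sub_nonneg.2 h1
  exact sum_le_sum fun A hA ↦ mul_le_mul_of_nonneg_left (h A (mem_powerset.1 hA)) (by positivity)

theorem bexp_nonneg (h0 : 0 ≤ q) (h1 : q ≤ 1) (h : ∀ A ⊆ s, 0 ≤ f A) : 0 ≤ bexp q s f := by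
  simpa only [bexp_const] using bexp_mono (f := fun _ ↦ 0) h0 h1 h

theorem sq_bexp_le (h0 : 0 ≤ q) (h1 : q ≤ 1) : bexp q s f ^ 2 ≤ bexp q s fun A ↦ f A ^ 2 := by
  have h := bexp_nonneg (q := q) (s := s) (f := fun A ↦ (f A - bexp q s f) ^ 2) h0 h1
    fun A _ ↦ sq_nonneg _
  have e : bexp q s (fun A ↦ (f A - bexp q s f) ^ 2)
      = bexp q s (fun A ↦ f A ^ 2) - bexp q s f ^ 2 := by
    have : ∀ A, (f A - bexp q s f) ^ 2
        = f A ^ 2 - (2 * bexp q s f) * f A + bexp q s f ^ 2 := fun A ↦ by ring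
    simp only [this]
    rw [bexp_add, bexp_sub, bexp_const_mul, bexp_const]
    ring
  linarith

theorem bexp_sq_sub (c : ℝ) : bexp q s (fun A ↦ (f A - c) ^ 2)
    = bexp q s (fun A ↦ f A ^ 2) - 2 * c * bexp q s f + c ^ 2 := by
  have : ∀ A, (f A - c) ^ 2 = f A ^ 2 - (2 * c) * f A + c ^ 2 := fun A ↦ by ring
  simp only [this]
  rw [bexp_add, bexp_sub, bexp_const_mul, bexp_const]

theorem bexp_union (h : Disjoint s t) :
    bexp q (s ∪ t) f = bexp q s fun A ↦ bexp q t fun B ↦ f (A ∪ B) := by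
  induction s using Finset.induction_on generalizing f with
  | empty => simp [bexp_empty]
  | insert a s ha ih =>
    rw [disjoint_insert_left] at h
    rw [insert_union, bexp_insert (by simp [ha, h.1]), bexp_insert ha, ih h.2, ih h.2]
    simp only [insert_union]

theorem bexp_prod (w : α → ℝ) :
    bexp q s (fun A ↦ ∏ i ∈ A, w i) = ∏ i ∈ s, (1 - q + q * w i) := by
  induction s using Finset.induction_on with
  | empty => simp [bexp_empty]
  | insert a s ha ih =>
    rw [bexp_insert ha, prod_insert ha, ← ih, add_mul, mul_assoc, ← bexp_const_mul (w a)]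
    congr 2
    exact bexp_congr fun A hA ↦ prod_insert fun h ↦ ha (hA h)

/-- **Efron–Stein inequality** for a random subset: the variance is at most the expected sum of the
squares of the effects of deleting a single element of the random set. -/
theorem efron_stein (h0 : 0 ≤ q) (h1 : q ≤ 1) :
    bexp q s (fun A ↦ f A ^ 2) - bexp q s f ^ 2
      ≤ bexp q s fun A ↦ ∑ e ∈ A, (f A - f (A.erase e)) ^ 2 := by
  induction s using Finset.induction_on generalizing f with
  | empty => simp [bexp_empty]
  | insert a s ha ih =>
    have i0 := ih (f := f)
    have i1 := ih (f := fun A ↦ f (insert a A))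
    have i2 := sq_bexp_le (q := q) (s := s) (f := fun A ↦ f (insert a A) - f A) h0 h1
    rw [bexp_sub] at i2
    have key : bexp q s (fun A ↦ ∑ e ∈ insert a A, (f (insert a A) - f ((insert a A).erase e)) ^ 2)
        = bexp q s (fun A ↦ (f (insert a A) - f A) ^ 2)
          + bexp q s (fun A ↦ ∑ e ∈ A, (f (insert a A) - f (insert a (A.erase e))) ^ 2) := by
      rw [← bexp_add]
      refine bexp_congr fun A hA ↦ ?_
      have hA' : a ∉ A := fun h ↦ ha (hA h)
      rw [sum_insert hA', erase_insert hA']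
      congr 1
      refine sum_congr rfl fun e he ↦ ?_
      rw [erase_insert_of_ne (fun h : a = e ↦ hA' (h ▸ he))]
    simp only [bexp_insert ha]
    rw [key]
    have h2 : 0 ≤ 1 - q := sub_nonneg.2 h1
    have j0 := mul_le_mul_of_nonneg_left i0 h2
    have j1 := mul_le_mul_of_nonneg_left i1 h0
    have j2 := mul_le_mul_of_nonneg_left i2 (mul_nonneg h0 h2)
    have h3 : 0 ≤ q * q * bexp q s (fun A ↦ (f (insert a A) - f A) ^ 2) :=
      mul_nonneg (mul_nonneg h0 h0) (bexp_nonneg h0 h1 fun A _ ↦ sq_nonneg _)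
    nlinarith

theorem bprob_mono (h0 : 0 ≤ q) (h1 : q ≤ 1) (h : ∀ A ⊆ s, P A → Q A) :
    bprob q s P ≤ bprob q s Q := by
  classical
  refine bexp_mono h0 h1 fun A hA ↦ ?_
  by_cases hP : P A
  · simp [hP, h A hA hP]
  · rw [if_neg hP]
    positivity

theorem bprob_or_le (h0 : 0 ≤ q) (h1 : q ≤ 1) :
    bprob q s (fun A ↦ P A ∨ Q A) ≤ bprob q s P + bprob q s Q := by
  classical
  unfold bprob
  rw [← bexp_add]
  refine bexp_mono h0 h1 fun A hA ↦ ?_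
  by_cases hP : P A <;> by_cases hQ : Q A <;> simp [hP, hQ]

theorem bprob_exists_le {ι : Type*} (h0 : 0 ≤ q) (h1 : q ≤ 1) (I : Finset ι)
    (R : ι → Finset α → Prop) :
    bprob q s (fun A ↦ ∃ i ∈ I, R i A) ≤ ∑ i ∈ I, bprob q s (R i) := by
  classical
  unfold bprob
  rw [← bexp_sum]
  refine bexp_mono h0 h1 fun A hA ↦ ?_
  split_ifs with h
  · obtain ⟨i, hi, hR⟩ := h
    refine le_trans (by simp [hR]) (single_le_sum (f := fun i ↦ if R i A then (1 : ℝ) else 0)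
      (fun j _ ↦ by positivity) hi)
  · positivity

/-- Markov's inequality. -/
theorem bprob_le_bexp (h0 : 0 ≤ q) (h1 : q ≤ 1) (hf : ∀ A ⊆ s, 0 ≤ f A)
    (hP : ∀ A ⊆ s, P A → 1 ≤ f A) : bprob q s P ≤ bexp q s f := by
  classical
  refine bexp_mono h0 h1 fun A hA ↦ ?_
  split_ifs with h
  exacts [hP A hA h, hf A hA]

theorem bprob_subset {F : Finset α} (hF : F ⊆ s) : bprob q s (fun A ↦ F ⊆ A) = q ^ #F := by
  classical
  have h : ∏ i ∈ s, (q + if i ∈ F then 0 else 1 - q) = q ^ #F := by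
    rw [← prod_sdiff hF, ← prod_const, prod_eq_one, one_mul]
    · exact prod_congr rfl fun i hi ↦ by simp [hi]
    · intro i hi
      simp [(mem_sdiff.1 hi).2]
  rw [← h, prod_add]
  refine sum_congr rfl fun A hA ↦ ?_
  rw [prod_const, mul_assoc]
  congr 1
  dsimp only
  split_ifs with hFA
  · rw [mul_one, ← prod_const]
    exact prod_congr rfl fun i hi ↦ by rw [if_neg fun h ↦ (mem_sdiff.1 hi).2 (hFA h)]
  · obtain ⟨i, hi, hiA⟩ := not_subset.1 hFA
    rw [mul_zero, prod_eq_zero (mem_sdiff.2 ⟨hF hi, hiA⟩) (by simp [hi])]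

/-- The moment generating function of the number of random elements that fall into `F`. -/
theorem bexp_exp_card_inter {F : Finset α} (hF : F ⊆ s) (l : ℝ) :
    bexp q s (fun A ↦ Real.exp (l * #(A ∩ F))) = (1 - q + q * Real.exp l) ^ #F := by
  have e : ∀ A : Finset α, Real.exp (l * #(A ∩ F)) = ∏ i ∈ A, if i ∈ F then Real.exp l else 1 := by
    intro A
    rw [prod_ite_mem, prod_const, ← Real.exp_nat_mul, mul_comm]
  simp only [e]
  rw [bexp_prod, ← prod_sdiff hF, ← prod_const, prod_eq_one, one_mul]
  · exact prod_congr rfl fun i hi ↦ by simp [hi]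
  · intro i hi
    simp [(mem_sdiff.1 hi).2]

theorem bexp_exp_card_inter_le {F : Finset α} (h0 : 0 ≤ q) (h1 : q ≤ 1) (hF : F ⊆ s) (l : ℝ) :
    bexp q s (fun A ↦ Real.exp (l * #(A ∩ F))) ≤ Real.exp (q * #F * (Real.exp l - 1)) := by
  rw [bexp_exp_card_inter hF]
  have h2 : 0 ≤ 1 - q := sub_nonneg.2 h1
  calc (1 - q + q * Real.exp l) ^ #F ≤ Real.exp (q * (Real.exp l - 1)) ^ #F := by
        gcongr
        linarith [Real.add_one_le_exp (q * (Real.exp l - 1))]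
    _ = _ := by rw [← Real.exp_nat_mul]; congr 1; ring

/-- Chernoff bound for the upper tail. -/
theorem bprob_le_card_inter {F : Finset α} (h0 : 0 ≤ q) (h1 : q ≤ 1) (hF : F ⊆ s) (m : ℝ) :
    bprob q s (fun A ↦ m ≤ #(A ∩ F)) ≤ Real.exp (7 / 4 * (q * #F) - m) := by
  calc bprob q s (fun A ↦ m ≤ #(A ∩ F))
      ≤ bexp q s (fun A ↦ Real.exp (-m) * Real.exp (1 * #(A ∩ F))) := by
        refine bprob_le_bexp h0 h1 (fun A _ ↦ by positivity) fun A _ h ↦ ?_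
        rw [← Real.exp_add]
        exact Real.one_le_exp (by linarith)
    _ ≤ Real.exp (-m) * Real.exp (q * #F * (Real.exp 1 - 1)) := by
        rw [bexp_const_mul]
        gcongr
        exact bexp_exp_card_inter_le h0 h1 hF 1
    _ ≤ _ := by
        rw [← Real.exp_add]
        have := Real.exp_one_lt_d9
        have h : 0 ≤ q * #F := by positivity
        gcongr
        nlinarith

/-- Chernoff bound for the lower tail. -/
theorem bprob_card_inter_le {F : Finset α} (h0 : 0 ≤ q) (h1 : q ≤ 1) (hF : F ⊆ s) (m : ℝ) :
    bprob q s (fun A ↦ #(A ∩ F) ≤ m) ≤ Real.exp (m - 3 / 5 * (q * #F)) := by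
  calc bprob q s (fun A ↦ #(A ∩ F) ≤ m)
      ≤ bexp q s (fun A ↦ Real.exp m * Real.exp (-1 * #(A ∩ F))) := by
        refine bprob_le_bexp h0 h1 (fun A _ ↦ by positivity) fun A _ h ↦ ?_
        rw [← Real.exp_add]
        exact Real.one_le_exp (by linarith)
    _ ≤ Real.exp m * Real.exp (q * #F * (Real.exp (-1) - 1)) := by
        rw [bexp_const_mul]
        gcongr
        exact bexp_exp_card_inter_le h0 h1 hF (-1)
    _ ≤ _ := by
        rw [← Real.exp_add]
        have := Real.exp_neg_one_lt_d9
        have h : 0 ≤ q * #F := by positivity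
        gcongr
        nlinarith

end RandomSubset

/-! ### Perfect matchings in expanding graphs -/

section Matching

variable {V : Type*} [Fintype V] [DecidableEq V]

/-- In an expanding graph, the complement of `S` does not split into `#S + 2` or more parts (indexed
by `ι`, with `c v` the part of the vertex `v ∉ S`) that have no edges between them. -/
theorem card_parts_lt_of_expansion (G : SimpleGraph V) {k : ℕ} (hcard : 6 * k < Fintype.card V)
    (hexp : ∀ X : Finset V, X.Nonempty → #X ≤ k →
      ∃ N : Finset V, #X < #N ∧ ∀ v ∈ N, v ∉ X ∧ ∃ x ∈ X, G.Adj x v)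
    (hjoin : ∀ X Y : Finset V, Disjoint X Y → k ≤ #X → k ≤ #Y → ∃ x ∈ X, ∃ y ∈ Y, G.Adj x y)
    {ι : Type*} [Fintype ι] [DecidableEq ι] (S : Finset V) (c : V → Option ι)
    (hS : ∀ v, c v = none ↔ v ∈ S) (hc : ∀ i, ∃ v, c v = some i)
    (hadj : ∀ u v i j, G.Adj u v → c u = some i → c v = some j → i = j) :
    Fintype.card ι < #S + 2 := by
  by_contra! hι
  -- `U F` is the union of the parts in `F`.
  let U : Finset ι → Finset V := fun F ↦ univ.filter fun v ↦ ∃ i ∈ F, c v = some i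
  have memU : ∀ F v, v ∈ U F ↔ ∃ i ∈ F, c v = some i := fun F v ↦ by simp [U]
  have cardU : ∀ F, #F ≤ #(U F) := by
    intro F
    choose r hr using hc
    refine card_le_card_of_injOn r (fun i hi ↦ (memU F _).2 ⟨i, hi, hr i⟩) fun i _ j _ h ↦ ?_
    have := hr i
    rw [h, hr j] at this
    exact (Option.some.inj this).symm
  have hUc : ∀ F, Disjoint (U F) (U Fᶜ) := by
    intro F
    refine disjoint_left.2 fun v h1 h2 ↦ ?_
    obtain ⟨i, hi, h1⟩ := (memU F v).1 h1
    obtain ⟨j, hj, h2⟩ := (memU _ v).1 h2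
    rw [h1] at h2
    exact mem_compl.1 hj (Option.some.inj h2 ▸ hi)
  have hUS : ∀ F, #(U F) + #(U Fᶜ) + #S = Fintype.card V := by
    intro F
    have h1 : U F ∪ U Fᶜ = Sᶜ := by
      ext v
      rw [mem_union, memU, memU, mem_compl, ← hS]
      cases h : c v with
      | none => simp
      | some i => by_cases hi : i ∈ F <;> simp [hi]
    rw [← card_union_of_disjoint (hUc F), h1, card_compl, Nat.sub_add_cancel (card_le_univ S)]
  have huniv : k ≤ #(U univ) := by
    have h1 := hUS univ
    have h2 := cardU univ
    have h3 : U univᶜ = ∅ := by ext v; simp [memU]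
    rw [h3, card_empty] at h1
    rw [card_univ] at h2
    omega
  obtain ⟨F, hFk, hFmin⟩ : ∃ F, k ≤ #(U F) ∧ ∀ i ∈ F, #(U (F.erase i)) < k := by
    obtain ⟨F, hF, hmin⟩ := exists_min_image (univ.filter fun F ↦ k ≤ #(U F)) card
      ⟨univ, by simpa using huniv⟩
    refine ⟨F, (mem_filter.1 hF).2, fun i hi ↦ ?_⟩
    by_contra! h
    have := hmin (F.erase i) (by simpa using h)
    have := card_erase_lt_of_mem hi
    omega
  have hno : ∀ u v, u ∈ U Fᶜ → G.Adj u v → v ∉ U Fᶜ → v ∈ S := by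
    intro u v hu huv hv
    obtain ⟨i, hi, hui⟩ := (memU _ u).1 hu
    by_contra hvS
    rw [← hS] at hvS
    obtain ⟨j, hj⟩ := Option.ne_none_iff_exists'.1 hvS
    exact hv ((memU _ v).2 ⟨j, hadj u v i j huv hui hj ▸ hi, hj⟩)
  have hFc : #(U Fᶜ) < k := by
    by_contra! h
    obtain ⟨x, hx, y, hy, hxy⟩ := hjoin _ _ (hUc F) hFk h
    have h1 := hno y x hy hxy.symm (disjoint_left.1 (hUc F) hx)
    obtain ⟨i, _, hi⟩ := (memU _ x).1 hx
    rw [← hS, hi] at h1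
    cases h1
  have hFcS : #Fᶜ ≤ #S := by
    rcases Fᶜ.eq_empty_or_nonempty with h | h
    · simp [h]
    · obtain ⟨N, hN, hN'⟩ := hexp (U Fᶜ)
        (card_pos.1 ((card_pos.2 h).trans_le (cardU _))) hFc.le
      have hNS : #N ≤ #S := card_le_card fun v hv ↦ by
        obtain ⟨h1, x, hx, hxv⟩ := hN' v hv
        exact hno x v hx hxv h1
      have := cardU Fᶜ
      omega
  rw [card_compl] at hFcS
  obtain ⟨i, hi, j, hj, hij⟩ := one_lt_card.1 (show 1 < #F by omega)
  have hFU : U F ⊆ U (F.erase i) ∪ U (F.erase j) := by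
    intro v hv
    obtain ⟨l, hl, hvl⟩ := (memU _ v).1 hv
    rw [mem_union, memU, memU]
    by_cases hli : l = i
    · exact Or.inr ⟨l, mem_erase.2 ⟨hli ▸ hij, hl⟩, hvl⟩
    · exact Or.inl ⟨l, mem_erase.2 ⟨hli, hl⟩, hvl⟩
  have h1 := (card_le_card hFU).trans (card_union_le _ _)
  have h2 := hFmin i hi
  have h3 := hFmin j hj
  have h4 := hUS F
  have h5 := cardU F
  have h6 := cardU Fᶜ
  rw [card_compl] at h6
  omega

theorem exists_isPerfectMatching_of_expansion (G : SimpleGraph V) {k : ℕ}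
    (heven : Even (Fintype.card V)) (hcard : 6 * k < Fintype.card V)
    (hexp : ∀ X : Finset V, X.Nonempty → #X ≤ k →
      ∃ N : Finset V, #X < #N ∧ ∀ v ∈ N, v ∉ X ∧ ∃ x ∈ X, G.Adj x v)
    (hjoin : ∀ X Y : Finset V, Disjoint X Y → k ≤ #X → k ≤ #Y → ∃ x ∈ X, ∃ y ∈ Y, G.Adj x y) :
    ∃ M : G.Subgraph, M.IsPerfectMatching := by
  classical
  rw [SimpleGraph.tutte]
  intro S hS
  set G' := ((⊤ : G.Subgraph).deleteVerts S) with hG'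
  have hmem : ∀ v, v ∈ G'.verts ↔ v ∉ S := fun v ↦ by simp [hG']
  let c : V → Option G'.coe.ConnectedComponent := fun v ↦
    if h : v ∈ G'.verts then some (G'.coe.connectedComponentMk ⟨v, h⟩) else none
  have hlt := card_parts_lt_of_expansion G hcard hexp hjoin (S.toFinset) c
    (fun v ↦ by by_cases h : v ∈ S <;> simp [c, hmem, h])
    (fun i ↦ by
      induction i using SimpleGraph.ConnectedComponent.ind with
      | h v => exact ⟨v, by simp [c]⟩)
    (fun u v i j huv hu hv ↦ by
      by_cases h1 : u ∈ G'.verts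
      swap
      · simp [c, h1] at hu
      by_cases h2 : v ∈ G'.verts
      swap
      · simp [c, h2] at hv
      simp only [c, h1, h2, dif_pos, Option.some.injEq] at hu hv
      rw [← hu, ← hv, SimpleGraph.ConnectedComponent.eq]
      apply SimpleGraph.Adj.reachable
      have h3 := (hmem u).1 h1
      have h4 := (hmem v).1 h2
      simp [hG', huv, h3, h4])
  have h1 : G'.coe.oddComponents.ncard ≤ Fintype.card G'.coe.ConnectedComponent := by
    rw [← Nat.card_eq_fintype_card]
    exact Set.ncard_le_card _
  have h2 := SimpleGraph.odd_ncard_oddComponents G'.coe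
  have h3 : Nat.card G'.verts + S.ncard = Fintype.card V := by
    have : G'.verts = Sᶜ := by ext v; simp [hmem]
    rw [this, ← Nat.card_eq_fintype_card, Nat.card_coe_set_eq, add_comm, Set.ncard_add_ncard_compl]
  have h4 : S.ncard < G'.coe.oddComponents.ncard := hS
  rw [← Set.ncard_eq_toFinset_card'] at hlt
  rw [← h3] at heven
  have h5 : G'.coe.oddComponents.ncard = S.ncard + 1 := by omega
  rw [h5] at h2
  by_cases h6 : Even S.ncard
  · have := h2.1 h6.add_one
    rw [Nat.even_add] at heven
    exact Nat.not_even_iff_odd.2 this (heven.2 h6)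
  · have h7 : ¬ Odd (Nat.card G'.verts) := fun h ↦ by
      have h9 := h2.2 h
      rw [Nat.odd_add_one, Nat.not_odd_iff_even] at h9
      exact h6 h9
    rw [Nat.even_add] at heven
    exact h6 (heven.1 (Nat.not_odd_iff_even.1 h7))

end Matching

/-! ### Cliques and packings of triangles -/

section Packing

variable {V : Type*} [DecidableEq V]

/-- The pairs of distinct vertices of `Z`. -/
def pairsIn (Z : Finset V) : Finset (Sym2 V) := Z.sym2.filter fun e ↦ ¬ e.IsDiag

theorem mk_mem_pairsIn {Z : Finset V} {u v : V} : s(u, v) ∈ pairsIn Z ↔ u ∈ Z ∧ v ∈ Z ∧ u ≠ v := by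
  simp [pairsIn, and_assoc]

theorem pairsIn_mono {Z Z' : Finset V} (h : Z ⊆ Z') : pairsIn Z ⊆ pairsIn Z' :=
  filter_subset_filter _ (sym2_mono h)

theorem pairsIn_inter (Z Z' : Finset V) : pairsIn Z ∩ pairsIn Z' = pairsIn (Z ∩ Z') := by
  ext e
  induction e using Sym2.ind with
  | h u v => simp only [mem_inter, mk_mem_pairsIn]; tauto

theorem card_pairsIn (Z : Finset V) : #(pairsIn Z) = (#Z).choose 2 := by
  rw [← Sym2.card_image_offDiag]
  congr 1
  ext e
  induction e using Sym2.ind with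
  | h u v =>
    rw [mk_mem_pairsIn]
    simp only [mem_image, mem_offDiag, Prod.exists]
    constructor
    · rintro h
      exact ⟨u, v, h, rfl⟩
    · rintro ⟨a, b, ⟨ha, hb, hab⟩, h⟩
      rcases Sym2.eq_iff.1 h with ⟨rfl, rfl⟩ | ⟨rfl, rfl⟩
      exacts [⟨ha, hb, hab⟩, ⟨hb, ha, hab.symm⟩]

/-- A cover by cliques is a colouring of the complement. -/
theorem colorable_compl_of_cover {A : Finset (Sym2 V)} (𝒬 : Finset (Finset V))
    (hcl : ∀ Q ∈ 𝒬, pairsIn Q ⊆ A) (hcov : ∀ v, ∃ Q ∈ 𝒬, v ∈ Q) :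
    (SimpleGraph.fromEdgeSet (A : Set (Sym2 V)))ᶜ.Colorable #𝒬 := by
  choose g hg hvg using hcov
  have C : (SimpleGraph.fromEdgeSet (A : Set (Sym2 V)))ᶜ.Coloring 𝒬 :=
    SimpleGraph.Coloring.mk (fun v ↦ ⟨g v, hg v⟩) fun {u v} huv h ↦ by
      have h : g u = g v := by simpa using h
      rw [SimpleGraph.compl_adj, SimpleGraph.fromEdgeSet_adj] at huv
      have h1 : v ∈ g u := h ▸ hvg v
      exact huv.2 ⟨hcl _ (hg u) (mk_mem_pairsIn.2 ⟨hvg u, h1, huv.1⟩), huv.1⟩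
  simpa using C.colorable

variable [Fintype V]

/-- The vertex sets of the cliques with `k` vertices in the graph with edge set `A`. -/
def cliques (k : ℕ) (A : Finset (Sym2 V)) : Finset (Finset V) :=
  (univ.powersetCard k).filter fun t ↦ pairsIn t ⊆ A

theorem mem_cliques {k : ℕ} {A : Finset (Sym2 V)} {t : Finset V} :
    t ∈ cliques k A ↔ #t = k ∧ pairsIn t ⊆ A := by
  simp [cliques, mem_powersetCard]

/-- The vertex-disjoint families of triangles in the graph with edge set `A`. -/
def packings (A : Finset (Sym2 V)) : Finset (Finset (Finset V)) :=
  (cliques 3 A).powerset.filter fun P ↦ ∀ s ∈ P, ∀ t ∈ P, s ≠ t → Disjoint s t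

theorem mem_packings {A : Finset (Sym2 V)} {P : Finset (Finset V)} :
    P ∈ packings A ↔ P ⊆ cliques 3 A ∧ ∀ s ∈ P, ∀ t ∈ P, s ≠ t → Disjoint s t := by
  simp [packings]

/-- The largest number of vertex-disjoint triangles in the graph with edge set `A`. -/
def packingNumber (A : Finset (Sym2 V)) : ℕ := (packings A).sup card

theorem card_le_packingNumber {A : Finset (Sym2 V)} {P : Finset (Finset V)} (hP : P ∈ packings A) :
    #P ≤ packingNumber A := le_sup (f := card) hP

theorem exists_packing (A : Finset (Sym2 V)) : ∃ P ∈ packings A, #P = packingNumber A := by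
  have h : (packings A).Nonempty := ⟨∅, by simp [mem_packings]⟩
  obtain ⟨P, hP, h⟩ := exists_mem_eq_sup _ h card
  exact ⟨P, hP, h.symm⟩

theorem packingNumber_le_card_cliques (A : Finset (Sym2 V)) : packingNumber A ≤ #(cliques 3 A) := by
  obtain ⟨P, hP, h⟩ := exists_packing A
  exact h ▸ card_le_card (mem_packings.1 hP).1

theorem card_biUnion_packing {A : Finset (Sym2 V)} {P : Finset (Finset V)} (hP : P ∈ packings A) :
    #(P.biUnion id) = 3 * #P := by
  rw [mem_packings] at hP
  rw [card_biUnion (t := id) fun s hs t ht hst ↦ hP.2 s hs t ht hst,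
    sum_const_nat (f := fun t ↦ #(id t)) fun t ht ↦ (mem_cliques.1 (hP.1 ht)).1, mul_comm]

theorem three_mul_packingNumber_le (A : Finset (Sym2 V)) :
    3 * packingNumber A ≤ Fintype.card V := by
  obtain ⟨P, hP, h⟩ := exists_packing A
  rw [← h, ← card_biUnion_packing hP]
  exact card_le_univ _

theorem packingNumber_mono {A B : Finset (Sym2 V)} (h : A ⊆ B) :
    packingNumber A ≤ packingNumber B := by
  obtain ⟨P, hP, e⟩ := exists_packing A
  rw [mem_packings] at hP
  refine e ▸ card_le_packingNumber (mem_packings.2 ⟨fun t ht ↦ ?_, hP.2⟩)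
  have := mem_cliques.1 (hP.1 ht)
  exact mem_cliques.2 ⟨this.1, this.2.trans h⟩

/-- Deleting an edge destroys at most one triangle of a vertex-disjoint family. -/
theorem packingNumber_le_erase (A : Finset (Sym2 V)) (e : Sym2 V) :
    packingNumber A ≤ packingNumber (A.erase e) + 1 := by
  obtain ⟨P, hP, h⟩ := exists_packing A
  rw [mem_packings] at hP
  have h1 : P.filter (fun t ↦ e ∉ pairsIn t) ∈ packings (A.erase e) := by
    refine mem_packings.2 ⟨fun t ht ↦ ?_, fun s hs t ht ↦
      hP.2 s (mem_filter.1 hs).1 t (mem_filter.1 ht).1⟩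
    rw [mem_filter] at ht
    have := mem_cliques.1 (hP.1 ht.1)
    exact mem_cliques.2 ⟨this.1, subset_erase.2 ⟨this.2, ht.2⟩⟩
  have h2 : #(P.filter (fun t ↦ ¬ e ∉ pairsIn t)) ≤ 1 := by
    refine card_le_one.2 fun s hs t ht ↦ ?_
    rw [mem_filter, not_not] at hs ht
    by_contra hst
    have hd := hP.2 s hs.1 t ht.1 hst
    have : e ∈ pairsIn (s ∩ t) := pairsIn_inter s t ▸ mem_inter.2 ⟨hs.2, ht.2⟩
    rw [disjoint_iff_inter_eq_empty.1 hd] at this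
    simp [pairsIn] at this
  have h3 := card_filter_add_card_filter_not (s := P) (fun t ↦ e ∉ pairsIn t)
  have h4 := card_le_packingNumber h1
  omega

/-- Only the edges of a fixed largest packing can affect the packing number. -/
theorem sum_sq_packingNumber_sub_erase_le (A : Finset (Sym2 V)) :
    ∑ e ∈ A, ((packingNumber A : ℝ) - packingNumber (A.erase e)) ^ 2 ≤ 3 * packingNumber A := by
  obtain ⟨P, hP, h⟩ := exists_packing A
  have hP' := mem_packings.1 hP
  calc ∑ e ∈ A, ((packingNumber A : ℝ) - packingNumber (A.erase e)) ^ 2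
      ≤ ∑ e ∈ A, if e ∈ P.biUnion pairsIn then (1 : ℝ) else 0 := by
        refine sum_le_sum fun e _ ↦ ?_
        have h1 : (packingNumber A : ℝ) ≤ packingNumber (A.erase e) + 1 :=
          mod_cast packingNumber_le_erase A e
        have h2 : (packingNumber (A.erase e) : ℝ) ≤ packingNumber A :=
          mod_cast packingNumber_mono (erase_subset e A)
        split_ifs with he
        · nlinarith
        · have h3 : packingNumber A ≤ packingNumber (A.erase e) := by
            refine h ▸ card_le_packingNumber (mem_packings.2 ⟨fun t ht ↦ ?_, hP'.2⟩)
            have := mem_cliques.1 (hP'.1 ht)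
            exact mem_cliques.2 ⟨this.1, subset_erase.2
              ⟨this.2, fun h ↦ he (mem_biUnion.2 ⟨t, ht, h⟩)⟩⟩
          have h4 : (packingNumber A : ℝ) ≤ packingNumber (A.erase e) := mod_cast h3
          rw [le_antisymm h4 h2]
          simp
    _ ≤ #(P.biUnion pairsIn) := by
        rw [sum_boole]
        exact mod_cast card_le_card fun e he ↦ (mem_filter.1 he).2
    _ ≤ ((3 * packingNumber A : ℕ) : ℝ) := by
        norm_cast
        rw [mul_comm, ← h]
        refine card_biUnion_le_card_mul _ _ _ fun t ht ↦ ?_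
        rw [card_pairsIn, (mem_cliques.1 (hP'.1 ht)).1]
        decide
    _ = _ := by push_cast; rfl

/-! ### The chromatic number of the complement -/

/-- A colour class of the complement with at least three vertices contains a triangle, and one with
`i` vertices contains at least `i - 3` cliques with four vertices. -/
theorem card_le_of_coloring_compl {A : Finset (Sym2 V)} {m : ℕ}
    (C : (SimpleGraph.fromEdgeSet (A : Set (Sym2 V)))ᶜ.Coloring (Fin m)) :
    Fintype.card V ≤ 2 * m + packingNumber A + #(cliques 4 A) := by
  let Q : Fin m → Finset V := fun i ↦ univ.filter fun v ↦ C v = i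
  have hQ : ∀ i, pairsIn (Q i) ⊆ A := by
    intro i e
    induction e using Sym2.ind with
    | h u v =>
      rw [mk_mem_pairsIn]
      rintro ⟨hu, hv, huv⟩
      by_contra he
      refine C.valid (v := u) (w := v) ?_ ((mem_filter.1 hu).2.trans (mem_filter.1 hv).2.symm)
      rw [SimpleGraph.compl_adj, SimpleGraph.fromEdgeSet_adj]
      exact ⟨huv, fun h ↦ he h.1⟩
  have hdisj : ∀ i j, i ≠ j → Disjoint (Q i) (Q j) := fun i j hij ↦
    disjoint_left.2 fun v hi hj ↦ hij ((mem_filter.1 hi).2.symm.trans (mem_filter.1 hj).2)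
  have hcard : Fintype.card V = ∑ i, #(Q i) :=
    card_eq_sum_card_fiberwise fun v _ ↦ mem_univ (C v)
  have hsub : ∀ i, ∀ s ⊆ Q i, ∀ j, ∀ t ⊆ Q j, s.Nonempty → s = t → i = j := by
    rintro i s hs j t ht ⟨v, hv⟩ rfl
    by_contra hij
    exact disjoint_left.1 (hdisj i j hij) (hs hv) (ht hv)
  -- the classes that contain a triangle
  let I : Finset (Fin m) := univ.filter fun i ↦ 3 ≤ #(Q i)
  have h3 : #I ≤ packingNumber A := by
    have : ∀ i, ∃ t ⊆ Q i, i ∈ I → #t = 3 := by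
      intro i
      by_cases h : i ∈ I
      · obtain ⟨t, ht, h⟩ := exists_subset_card_eq (mem_filter.1 h).2
        exact ⟨t, ht, fun _ ↦ h⟩
      · exact ⟨∅, empty_subset _, fun h' ↦ (h h').elim⟩
    choose t ht ht3 using this
    have hinj : Set.InjOn t I := fun i hi j _ hij ↦
      hsub i _ (ht i) j _ (ht j) (card_pos.1 (by rw [ht3 i hi]; norm_num)) hij
    rw [← card_image_of_injOn hinj]
    refine card_le_packingNumber (mem_packings.2 ⟨fun s hs ↦ ?_, fun s hs r hr hsr ↦ ?_⟩)
    · obtain ⟨i, hi, rfl⟩ := mem_image.1 hs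
      exact mem_cliques.2 ⟨ht3 i hi, (pairsIn_mono (ht i)).trans (hQ i)⟩
    · obtain ⟨i, hi, rfl⟩ := mem_image.1 hs
      obtain ⟨j, hj, rfl⟩ := mem_image.1 hr
      exact (hdisj i j fun h ↦ hsr (h ▸ rfl)).mono (ht i) (ht j)
  have h4 : ∑ i, #((Q i).powersetCard 4) ≤ #(cliques 4 A) := by
    rw [← card_biUnion]
    · refine card_le_card fun t ht ↦ ?_
      obtain ⟨i, _, hi⟩ := mem_biUnion.1 ht
      rw [mem_powersetCard] at hi
      exact mem_cliques.2 ⟨hi.2, (pairsIn_mono hi.1).trans (hQ i)⟩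
    · intro i _ j _ hij
      refine disjoint_left.2 fun t hi hj ↦ hij ?_
      rw [mem_powersetCard] at hi hj
      exact hsub i t hi.1 j t hj.1 (card_pos.1 (by rw [hi.2]; norm_num)) rfl
  calc Fintype.card V = ∑ i, #(Q i) := hcard
    _ ≤ ∑ i : Fin m, (2 + (if 3 ≤ #(Q i) then 1 else 0) + #((Q i).powersetCard 4)) := by
        refine sum_le_sum fun i _ ↦ ?_
        rw [card_powersetCard]
        split_ifs with h
        · have h5 : ∀ j : ℕ, j ≤ (j + 3).choose 4 := by
            intro j
            induction j with
            | zero => simp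
            | succ j ih =>
              have : 0 < (j + 3).choose 3 := Nat.choose_pos (by omega)
              rw [show j + 1 + 3 = (j + 3) + 1 by omega, Nat.choose_succ_succ' _ 3,
                show 3 + 1 = 4 from rfl]
              omega
          have := h5 (#(Q i) - 3)
          rw [Nat.sub_add_cancel h] at this
          omega
        · omega
    _ ≤ _ := by
        rw [sum_add_distrib, sum_add_distrib, sum_boole, sum_const, card_univ, Fintype.card_fin,
          smul_eq_mul, mul_comm m 2]
        have : ((#(univ.filter fun i ↦ 3 ≤ #(Q i)) : ℕ)) = #I := rfl
        simp only [Nat.cast_id, this]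
        omega

/-- If every vertex of `X` has at least `D` neighbours in `Z ⊇ X`, then `Z` spans at least
`#X * D / 2` edges. -/
theorem mul_le_card_inter_pairsIn {A : Finset (Sym2 V)} (hA : A ⊆ pairsIn univ) {X Z : Finset V}
    (hXZ : X ⊆ Z) {D : ℝ} (hD : ∀ x ∈ X, D ≤ #(Z.filter fun u ↦ s(x, u) ∈ A)) :
    #X * D ≤ 2 * #(A ∩ pairsIn Z) := by
  have h1 : ∑ x ∈ X, #((A ∩ pairsIn Z).filter fun e ↦ x ∈ e)
      = ∑ e ∈ A ∩ pairsIn Z, #(X.filter fun x ↦ x ∈ e) :=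
    sum_card_bipartiteAbove_eq_sum_card_bipartiteBelow _
  have h2 : ∑ e ∈ A ∩ pairsIn Z, #(X.filter fun x ↦ x ∈ e) ≤ #(A ∩ pairsIn Z) * 2 := by
    refine sum_le_card_nsmul _ _ _ fun e _ ↦ ?_
    induction e using Sym2.ind with
    | h u v =>
      refine (card_le_card (t := {u, v}) fun x hx ↦ ?_).trans card_le_two
      simpa using (mem_filter.1 hx).2
  have h3 : #X * D ≤ ∑ x ∈ X, (#((A ∩ pairsIn Z).filter fun e ↦ x ∈ e) : ℝ) := by
    rw [← nsmul_eq_mul]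
    refine card_nsmul_le_sum _ _ _ fun x hx ↦ (hD x hx).trans ?_
    norm_cast
    refine card_le_card_of_injOn (fun u ↦ s(x, u)) (fun u hu ↦ ?_) fun u _ v _ h ↦ ?_
    · have hu : u ∈ Z ∧ s(x, u) ∈ A := by simpa using hu
      have h4 := (mk_mem_pairsIn.1 (hA hu.2)).2.2
      simp [hu.2, mk_mem_pairsIn, hXZ hx, hu.1, h4]
    · exact Sym2.congr_right.1 h
  rw [mul_comm 2]
  refine h3.trans ?_
  exact_mod_cast h1.trans_le h2

/-- If small sets span few edges and large sets are joined by edges, then every large set `U` of even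
size inside which all degrees are at least `D` has a perfect matching, given here as a cover of `U`
by `#U / 2` edges. A small set `X ⊆ U` expands, since otherwise `X` and its neighbours would span too
many edges. -/
theorem exists_cover_by_edges {A : Finset (Sym2 V)} (hA : A ⊆ pairsIn univ) {k : ℕ} {D : ℝ}
    (hD0 : 0 ≤ D)
    (hsparse : ∀ Z : Finset V, Z.Nonempty → #Z ≤ 2 * k → 4 * (#(A ∩ pairsIn Z) : ℝ) < #Z * D)
    (hjoin : ∀ X Y : Finset V, Disjoint X Y → k ≤ #X → k ≤ #Y → ∃ x ∈ X, ∃ y ∈ Y, s(x, y) ∈ A)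
    (U : Finset V) (heven : Even #U) (hU : 6 * k < #U)
    (hdeg : ∀ u ∈ U, D ≤ #(U.filter fun v ↦ s(u, v) ∈ A)) :
    ∃ 𝒬 : Finset (Finset V), (∀ Q ∈ 𝒬, pairsIn Q ⊆ A) ∧ (∀ u ∈ U, ∃ Q ∈ 𝒬, u ∈ Q) ∧
      2 * #𝒬 ≤ #U := by
  let G : SimpleGraph U := (SimpleGraph.fromEdgeSet (A : Set (Sym2 V))).induce U
  have hG : ∀ u v : U, G.Adj u v ↔ s((u : V), (v : V)) ∈ A := by
    intro u v
    simp only [G, SimpleGraph.comap_adj, SimpleGraph.fromEdgeSet_adj, mem_coe,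
      Function.Embedding.subtype_apply]
    exact ⟨fun h ↦ h.1, fun h ↦ ⟨h, (mk_mem_pairsIn.1 (hA h)).2.2⟩⟩
  have hcardm : ∀ X : Finset U, #(X.map (Function.Embedding.subtype _)) = #X := fun X ↦ card_map _
  obtain ⟨M, hM⟩ := exists_isPerfectMatching_of_expansion G (k := k) (by simpa using heven)
    (by simpa using hU)
    (fun X hX hXk ↦ by
      let N : Finset U := univ.filter fun v ↦ v ∉ X ∧ ∃ x ∈ X, G.Adj x v
      refine ⟨N, ?_, fun v hv ↦ (mem_filter.1 hv).2⟩
      by_contra! hN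
      let Z := (X ∪ N).map (Function.Embedding.subtype _)
      have hZ : #Z ≤ 2 * #X := by
        have := card_union_le X N
        rw [hcardm]
        omega
      have h1 := mul_le_card_inter_pairsIn hA (X := X.map (Function.Embedding.subtype _)) (Z := Z)
        (map_subset_map.2 subset_union_left) (D := D) (fun x hx ↦ by
          obtain ⟨x, hxX, rfl⟩ := mem_map.1 hx
          refine (hdeg x x.2).trans ?_
          norm_cast
          refine card_le_card fun v hv ↦ ?_
          rw [mem_filter] at hv ⊢
          refine ⟨mem_map.2 ⟨⟨v, hv.1⟩, ?_, rfl⟩, hv.2⟩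
          rw [mem_union]
          by_cases hvX : (⟨v, hv.1⟩ : U) ∈ X
          · exact Or.inl hvX
          · exact Or.inr (mem_filter.2 ⟨mem_univ _, hvX, x, hxX, (hG _ _).2 hv.2⟩))
      have h2 := hsparse Z (by
        rw [map_nonempty]
        exact hX.mono subset_union_left) (by omega)
      rw [hcardm] at h1
      have h3 : (#Z : ℝ) ≤ 2 * #X := mod_cast hZ
      nlinarith)
    (fun X Y hXY hX hY ↦ by
      obtain ⟨x, hx, y, hy, hxy⟩ := hjoin (X.map (Function.Embedding.subtype _))
        (Y.map (Function.Embedding.subtype _)) ((Finset.disjoint_map _).2 hXY) (by rwa [hcardm])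
        (by rwa [hcardm])
      obtain ⟨x', hx', rfl⟩ := mem_map.1 hx
      obtain ⟨y', hy', rfl⟩ := mem_map.1 hy
      exact ⟨x', hx', y', hy', (hG _ _).2 hxy⟩)
  rw [SimpleGraph.Subgraph.isPerfectMatching_iff] at hM
  choose r hr hr' using fun u ↦ hM u
  have hrr : ∀ u, r (r u) = u := fun u ↦ (hr' (r u) u (hr u).symm).symm
  have hru : ∀ u, r u ≠ u := fun u h ↦ by
    have := (hr u).ne
    rw [h] at this
    exact this rfl
  let g : U → Finset V := fun u ↦ {(u : V), (r u : V)}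
  refine ⟨univ.image g, fun Q hQ ↦ ?_, fun u hu ↦ ⟨g ⟨u, hu⟩, by simp, by simp [g]⟩, ?_⟩
  · obtain ⟨u, _, rfl⟩ := mem_image.1 hQ
    have h1 := (hG _ _).1 (hr u).adj_sub
    intro e
    induction e using Sym2.ind with
    | h a b =>
      rw [mk_mem_pairsIn]
      simp only [g, mem_insert, mem_singleton]
      rintro ⟨rfl | rfl, rfl | rfl, hab⟩
      exacts [(hab rfl).elim, h1, Sym2.eq_swap ▸ h1, (hab rfl).elim]
  · have h := mul_card_image_le_card_of_maps_to (s := (univ : Finset U)) (t := univ.image g) (f := g)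
      (fun u hu ↦ mem_image_of_mem _ hu) 2 (fun Q hQ ↦ by
        obtain ⟨u, _, rfl⟩ := mem_image.1 hQ
        refine le_trans (b := #{u, r u}) (card_pair (hru u).symm).ge (card_le_card ?_)
        intro v hv
        rw [mem_insert, mem_singleton] at hv
        rcases hv with rfl | rfl
        · simp
        · simp [g, hrr, pair_comm])
    simpa using h

end Packing

/-! ### Quasirandom graphs -/

section Quasirandom

variable {V : Type*} [DecidableEq V]

/-- The pairs that join `v` to the other vertices of `T`. -/
def spokes (v : V) (T : Finset V) : Finset (Sym2 V) := (T.erase v).image fun u ↦ s(v, u)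

theorem spokes_mono {v : V} {T T' : Finset V} (h : T ⊆ T') : spokes v T ⊆ spokes v T' :=
  image_subset_image (erase_subset_erase _ h)

theorem card_spokes (v : V) (T : Finset V) : #(spokes v T) = #(T.erase v) :=
  card_image_of_injective _ fun _ _ h ↦ Sym2.congr_right.1 h

variable [Fintype V]

theorem spokes_subset_pairsIn (v : V) (T : Finset V) : spokes v T ⊆ pairsIn univ := by
  intro e he
  obtain ⟨u, hu, rfl⟩ := mem_image.1 he
  exact mk_mem_pairsIn.2 ⟨mem_univ _, mem_univ _, (mem_erase.1 hu).1.symm⟩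

/-- The number of spokes in `A` is the number of neighbours in `T`. -/
theorem card_inter_spokes {A : Finset (Sym2 V)} (hA : A ⊆ pairsIn univ) (v : V) (T : Finset V) :
    #(A ∩ spokes v T) = #(T.filter fun u ↦ s(v, u) ∈ A) := by
  have : A ∩ spokes v T = (T.filter fun u ↦ s(v, u) ∈ A).image fun u ↦ s(v, u) := by
    ext e
    simp only [spokes, mem_inter, mem_image, mem_filter, mem_erase]
    constructor
    · rintro ⟨he, u, ⟨_, hu⟩, rfl⟩
      exact ⟨u, ⟨hu, he⟩, rfl⟩
    · rintro ⟨u, ⟨hu, he⟩, rfl⟩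
      exact ⟨he, u, ⟨(mk_mem_pairsIn.1 (hA he)).2.2.symm, hu⟩, rfl⟩
  rw [this, card_image_of_injective _ fun _ _ h ↦ Sym2.congr_right.1 h]

/-- The vertices that lie on a triangle of the graph with edge set `A`. -/
def triangleVerts (A : Finset (Sym2 V)) : Finset V := (cliques 3 A).biUnion id

theorem card_triangleVerts_le (A : Finset (Sym2 V)) :
    #(triangleVerts A) ≤ 3 * #(cliques 3 A) := by
  rw [mul_comm]
  exact card_biUnion_le_card_mul _ _ _ fun t ht ↦ (mem_cliques.1 ht).1.le

/-- The properties of a sparse random graph with average degree `d` that produce an optimal cover by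
triangles and edges; `k` is the size from which vertex sets count as large. In `few_spokes`, deleting
the edges at `v` makes the set of vertices on triangles independent of the neighbourhood of `v`. -/
structure IsQuasirandom (d : ℝ) (k : ℕ) (A : Finset (Sym2 V)) : Prop where
  few_triangles : 60 * #(cliques 3 A) ≤ Fintype.card V
  degree : ∀ v, d / 2 < #(A ∩ spokes v univ)
  few_spokes : ∀ v, 20 * #(triangleVerts (A \ spokes v univ)) ≤ Fintype.card V →
    #(A ∩ spokes v (triangleVerts (A \ spokes v univ))) < d / 4
  sparse : ∀ Z : Finset V, Z.Nonempty → #Z ≤ 2 * k → 4 * (#(A ∩ pairsIn Z) : ℝ) < #Z * (d / 8)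
  joined : ∀ X Y : Finset V, Disjoint X Y → k ≤ #X → k ≤ #Y → ∃ x ∈ X, ∃ y ∈ Y, s(x, y) ∈ A

/-- Vertices off a largest packing of triangles keep at least half of their neighbours, so that a
perfect matching (up to one vertex) completes the packing to an optimal cover by cliques. -/
theorem IsQuasirandom.exists_colorable {d : ℝ} {k : ℕ} {A : Finset (Sym2 V)}
    (hA : A ⊆ pairsIn univ) (h : IsQuasirandom d k A) (hd : 8 ≤ d)
    (hk : 120 * k + 20 < 19 * Fintype.card V) :
    ∃ m : ℕ, (SimpleGraph.fromEdgeSet (A : Set (Sym2 V)))ᶜ.Colorable m ∧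
      2 * m + packingNumber A ≤ Fintype.card V + 1 := by
  obtain ⟨P, hP, hPcard⟩ := exists_packing A
  have hP' := mem_packings.1 hP
  set W := P.biUnion id with hW
  have hWcard : #W = 3 * packingNumber A := by rw [hW, card_biUnion_packing hP, hPcard]
  have hWn : 20 * #W ≤ Fintype.card V := by
    have h1 := packingNumber_le_card_cliques A
    have h2 := h.few_triangles
    omega
  have hWc : #Wᶜ + #W = Fintype.card V := by
    rw [card_compl, Nat.sub_add_cancel (card_le_univ _)]
  have hdeg : ∀ v ∉ W, d / 8 + 1 ≤ #(Wᶜ.filter fun u ↦ s(v, u) ∈ A) := by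
    intro v hv
    have hWT : W ⊆ triangleVerts (A \ spokes v univ) := by
      intro u hu
      obtain ⟨t, ht, hut⟩ := mem_biUnion.1 hu
      have h1 := mem_cliques.1 (hP'.1 ht)
      have hvt : v ∉ t := fun hvt ↦ hv (mem_biUnion.2 ⟨t, ht, hvt⟩)
      refine mem_biUnion.2 ⟨t, mem_cliques.2 ⟨h1.1, fun e he ↦ mem_sdiff.2 ⟨h1.2 he, fun he' ↦ ?_⟩⟩,
        hut⟩
      obtain ⟨w, _, rfl⟩ := mem_image.1 he'
      exact hvt (mk_mem_pairsIn.1 he).1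
    have h1 := h.degree v
    have h2 := h.few_spokes v <| by
      have h3 := card_triangleVerts_le (A \ spokes v univ)
      have h4 : #(cliques 3 (A \ spokes v univ)) ≤ #(cliques 3 A) := card_le_card fun t ht ↦ by
        rw [mem_cliques] at ht ⊢
        exact ⟨ht.1, ht.2.trans sdiff_subset⟩
      have := h.few_triangles
      omega
    have h3 : #(A ∩ spokes v univ) ≤ #(Wᶜ.filter fun u ↦ s(v, u) ∈ A)
        + #(A ∩ spokes v (triangleVerts (A \ spokes v univ))) := by
      rw [card_inter_spokes hA, card_inter_spokes hA]
      refine le_trans (card_le_card fun u hu ↦ ?_) (card_union_le _ _)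
      rw [mem_filter] at hu
      rw [mem_union, mem_filter, mem_filter, mem_compl]
      by_cases huW : u ∈ W
      · exact Or.inr ⟨hWT huW, hu.2⟩
      · exact Or.inl ⟨huW, hu.2⟩
    have h3' : (#(A ∩ spokes v univ) : ℝ) ≤ #(Wᶜ.filter fun u ↦ s(v, u) ∈ A)
        + #(A ∩ spokes v (triangleVerts (A \ spokes v univ))) := mod_cast h3
    linarith
  -- `L` holds the vertex that is left over when the parity is wrong.
  obtain ⟨L, hLW, hL1, hLeven⟩ : ∃ L ⊆ Wᶜ, #L ≤ 1 ∧ Even #(Wᶜ \ L) := by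
    rcases Nat.even_or_odd #Wᶜ with he | ho
    · exact ⟨∅, empty_subset _, by simp, by simpa using he⟩
    · obtain ⟨v, hv⟩ := card_pos.1 ho.pos
      refine ⟨{v}, by simpa using hv, by simp, ?_⟩
      rw [card_sdiff_of_subset (by simpa using hv), card_singleton]
      exact Nat.Odd.sub_odd ho odd_one
  have hLcard : #(Wᶜ \ L) + #L = #Wᶜ := card_sdiff_add_card_eq_card hLW
  obtain ⟨𝒬, hQ, hcov, hQcard⟩ := exists_cover_by_edges hA (D := d / 8) (by linarith) h.sparse
    h.joined (Wᶜ \ L) hLeven (by omega) (fun u hu ↦ by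
      have h1 := hdeg u (mem_compl.1 (mem_sdiff.1 hu).1)
      have h2 : #(Wᶜ.filter fun w ↦ s(u, w) ∈ A)
          ≤ #((Wᶜ \ L).filter fun w ↦ s(u, w) ∈ A) + #L := by
        refine le_trans (card_le_card fun w hw ↦ ?_) (card_union_le _ _)
        rw [mem_filter] at hw
        rw [mem_union, mem_filter]
        by_cases hwL : w ∈ L
        · exact Or.inr hwL
        · exact Or.inl ⟨mem_sdiff.2 ⟨hw.1, hwL⟩, hw.2⟩
      have h3 : (#(Wᶜ.filter fun w ↦ s(u, w) ∈ A) : ℝ)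
          ≤ #((Wᶜ \ L).filter fun w ↦ s(u, w) ∈ A) + 1 := by
        exact_mod_cast h2.trans (by omega)
      linarith)
  refine ⟨#(P ∪ 𝒬 ∪ L.image singleton), colorable_compl_of_cover _ (fun Q hQ' ↦ ?_) fun v ↦ ?_, ?_⟩
  · rw [mem_union, mem_union] at hQ'
    rcases hQ' with (hQ' | hQ') | hQ'
    · exact (mem_cliques.1 (hP'.1 hQ')).2
    · exact hQ Q hQ'
    · obtain ⟨v, _, rfl⟩ := mem_image.1 hQ'
      rw [card_eq_zero.1 (show #(pairsIn {v}) = 0 by simp [card_pairsIn])]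
      exact empty_subset _
  · by_cases hvW : v ∈ W
    · obtain ⟨t, ht, hvt⟩ := mem_biUnion.1 hvW
      exact ⟨t, mem_union_left _ (mem_union_left _ ht), hvt⟩
    · by_cases hvL : v ∈ L
      · exact ⟨{v}, mem_union_right _ (mem_image_of_mem _ hvL), mem_singleton_self v⟩
      · obtain ⟨Q, hQ', hv⟩ := hcov v (mem_sdiff.2 ⟨mem_compl.2 hvW, hvL⟩)
        exact ⟨Q, mem_union_left _ (mem_union_right _ hQ'), hv⟩
  · have h1 := card_union_le (P ∪ 𝒬) (L.image singleton)
    have h2 := card_union_le P 𝒬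
    have h3 := card_image_le (s := L) (f := (singleton : V → Finset V))
    omega

/-! ### The random graph is quasirandom -/

variable {q : ℝ}

theorem bexp_card_cliques (k : ℕ) :
    bexp q (pairsIn (univ : Finset V)) (fun A ↦ (#(cliques k A) : ℝ))
      = (Fintype.card V).choose k * q ^ (k.choose 2) := by
  classical
  have h : ∀ A : Finset (Sym2 V), (#(cliques k A) : ℝ)
      = ∑ t ∈ univ.powersetCard k, if pairsIn t ⊆ A then 1 else 0 := by
    intro A
    rw [sum_boole]
    rfl
  simp only [h]
  rw [bexp_sum, sum_congr rfl (g := fun _ ↦ q ^ (k.choose 2)), sum_const, card_powersetCard,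
    nsmul_eq_mul, card_univ]
  intro t ht
  have := bprob_subset (q := q) (pairsIn_mono (subset_univ t))
  rw [card_pairsIn, (mem_powersetCard.1 ht).2] at this
  rw [← this]
  unfold bprob
  congr!

theorem bprob_not_degree (h0 : 0 ≤ q) (h1 : q ≤ 1) (v : V) (m : ℝ) :
    bprob q (pairsIn univ) (fun A ↦ (#(A ∩ spokes v univ) : ℝ) ≤ m)
      ≤ Real.exp (m - 3 / 5 * (q * (Fintype.card V - 1))) := by
  refine (bprob_card_inter_le h0 h1 (spokes_subset_pairsIn v univ) m).trans_eq ?_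
  rw [card_spokes, card_erase_of_mem (mem_univ v), card_univ,
    Nat.cast_pred (Fintype.card_pos_iff.2 ⟨v⟩)]

theorem bprob_not_few_spokes (h0 : 0 ≤ q) (h1 : q ≤ 1) (v : V) (m : ℝ) :
    bprob q (pairsIn univ) (fun A ↦ 20 * #(triangleVerts (A \ spokes v univ)) ≤ Fintype.card V ∧
        m ≤ #(A ∩ spokes v (triangleVerts (A \ spokes v univ))))
      ≤ Real.exp (7 / 4 * (q * (Fintype.card V / 20)) - m) := by
  classical
  unfold bprob
  rw [← sdiff_union_of_subset (spokes_subset_pairsIn v univ), bexp_union sdiff_disjoint,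
    ← bexp_const (q := q) (s := pairsIn univ \ spokes v univ)
      (Real.exp (7 / 4 * (q * (Fintype.card V / 20)) - m))]
  refine bexp_mono h0 h1 fun B hB ↦ ?_
  have hBs : Disjoint B (spokes v univ) := disjoint_of_subset_left hB sdiff_disjoint
  by_cases hT : 20 * #(triangleVerts B) ≤ Fintype.card V
  · refine le_trans (bprob_mono (Q := fun C ↦ m ≤ #(C ∩ spokes v (triangleVerts B))) h0 h1
      fun C hC h ↦ ?_) ((bprob_le_card_inter h0 h1 (spokes_mono (subset_univ _)) m).trans ?_)
    · have e1 : (B ∪ C) \ spokes v univ = B := by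
        rw [union_sdiff_distrib, sdiff_eq_empty_iff_subset.2 hC, union_empty,
          sdiff_eq_self_of_disjoint hBs]
      have e2 : B ∩ spokes v (triangleVerts B) = ∅ :=
        disjoint_iff_inter_eq_empty.1 (hBs.mono_right (spokes_mono (subset_univ _)))
      have h := h.2
      rwa [e1, union_inter_distrib_right, e2, empty_union] at h
    · have h2 : #(spokes v (triangleVerts B)) ≤ #(triangleVerts B) :=
        (card_spokes v _).trans_le (card_le_card (erase_subset _ _))
      have h3 : (#(spokes v (triangleVerts B)) : ℝ) ≤ Fintype.card V / 20 := by
        rw [le_div_iff₀ (by norm_num)]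
        exact_mod_cast (by omega : #(spokes v (triangleVerts B)) * 20 ≤ Fintype.card V)
      gcongr
  · rw [bexp_congr (g := fun _ ↦ 0), bexp_const]
    · positivity
    · intro C hC
      have e1 : (B ∪ C) \ spokes v univ = B := by
        rw [union_sdiff_distrib, sdiff_eq_empty_iff_subset.2 hC, union_empty,
          sdiff_eq_self_of_disjoint hBs]
      exact if_neg fun h ↦ hT (e1 ▸ h.1)

theorem bprob_not_sparse (h0 : 0 ≤ q) (h1 : q ≤ 1) {d : ℝ} {k : ℕ} (hk : 112 * (q * k) ≤ d)
    (Z : Finset V) (hZ : #Z ≤ 2 * k) :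
    bprob q (pairsIn univ) (fun A ↦ #Z * (d / 8) ≤ 4 * (#(A ∩ pairsIn Z) : ℝ))
      ≤ Real.exp (-(d / 64)) ^ #Z := by
  refine (bprob_mono (Q := fun A ↦ (#Z * d / 32 : ℝ) ≤ #(A ∩ pairsIn Z)) h0 h1
    fun A _ h ↦ by linarith).trans ((bprob_le_card_inter h0 h1
      (pairsIn_mono (subset_univ Z)) _).trans ?_)
  rw [← Real.exp_nat_mul]
  have h2 : (#(pairsIn Z) : ℝ) ≤ #Z * k := by
    rw [card_pairsIn, Nat.choose_two_right]
    norm_cast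
    refine (Nat.div_le_div_right (Nat.mul_le_mul_left _ ((Nat.sub_le _ 1).trans hZ))).trans ?_
    rw [mul_left_comm, Nat.mul_div_cancel_left _ two_pos]
  have h3 : q * #(pairsIn Z) ≤ #Z * (d / 112) :=
    calc q * #(pairsIn Z) ≤ q * (#Z * k) := by gcongr
      _ = #Z * (q * k) := by ring
      _ ≤ _ := by gcongr; linarith
  gcongr
  linarith

theorem bprob_not_joined (h0 : 0 ≤ q) (h1 : q ≤ 1) {k : ℕ} (X Y : Finset V) (hXY : Disjoint X Y)
    (hX : k ≤ #X) (hY : k ≤ #Y) :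
    bprob q (pairsIn univ) (fun A ↦ ¬ ∃ x ∈ X, ∃ y ∈ Y, s(x, y) ∈ A)
      ≤ Real.exp (-(3 / 5 * (q * (k * k)))) := by
  let F : Finset (Sym2 V) := (X ×ˢ Y).image fun z ↦ s(z.1, z.2)
  have hF : F ⊆ pairsIn univ := by
    intro e he
    obtain ⟨z, hz, rfl⟩ := mem_image.1 he
    rw [mem_product] at hz
    exact mk_mem_pairsIn.2 ⟨mem_univ _, mem_univ _,
      fun h ↦ disjoint_left.1 hXY hz.1 (h ▸ hz.2)⟩
  have hFcard : k * k ≤ #F := by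
    rw [card_image_of_injOn, card_product]
    · exact Nat.mul_le_mul hX hY
    · rintro ⟨x, y⟩ hz ⟨x', y'⟩ hz' h
      rw [mem_coe, mem_product] at hz hz'
      rcases Sym2.eq_iff.1 h with ⟨rfl, rfl⟩ | ⟨rfl, rfl⟩
      · rfl
      · exact (disjoint_left.1 hXY hz.1 hz'.2).elim
  refine (bprob_mono (Q := fun A ↦ (#(A ∩ F) : ℝ) ≤ 0) h0 h1 fun A _ h ↦ ?_).trans
    ((bprob_card_inter_le h0 h1 hF 0).trans ?_)
  · rw [Nat.cast_nonpos, card_eq_zero]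
    refine eq_empty_of_forall_notMem fun e he ↦ h ?_
    rw [mem_inter] at he
    obtain ⟨z, hz, rfl⟩ := mem_image.1 he.2
    rw [mem_product] at hz
    exact ⟨z.1, hz.1, z.2, hz.2, he.1⟩
  · have : ((k * k : ℕ) : ℝ) ≤ #F := mod_cast hFcard
    push_cast at this
    rw [zero_sub]
    gcongr

/-- A second moment computation: distinct triangles are independent unless they share an edge. -/
theorem variance_card_triangles_le (h0 : 0 ≤ q) :
    bexp q (pairsIn (univ : Finset V)) (fun A ↦ (#(cliques 3 A) : ℝ) ^ 2)
        - bexp q (pairsIn (univ : Finset V)) (fun A ↦ (#(cliques 3 A) : ℝ)) ^ 2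
      ≤ (Fintype.card V : ℝ) ^ 3 * q ^ 3 + 3 * (Fintype.card V : ℝ) ^ 4 * q ^ 5 := by
  classical
  set n := Fintype.card V
  let K : Finset (Finset V) := (univ : Finset V).powersetCard 3
  have hK : #K ≤ n ^ 3 := by
    rw [card_powersetCard, card_univ]
    exact Nat.choose_le_pow _ _
  have h : ∀ A : Finset (Sym2 V), (#(cliques 3 A) : ℝ)
      = ∑ t ∈ K, if pairsIn t ⊆ A then 1 else 0 := by
    intro A
    rw [sum_boole]
    rfl
  have e1 : bexp q (pairsIn (univ : Finset V)) (fun A ↦ (#(cliques 3 A) : ℝ)) = ∑ t ∈ K, q ^ 3 := by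
    rw [bexp_card_cliques, sum_const, card_powersetCard, nsmul_eq_mul, card_univ]
    rfl
  have e2 : bexp q (pairsIn (univ : Finset V)) (fun A ↦ (#(cliques 3 A) : ℝ) ^ 2)
      = ∑ t ∈ K, ∑ r ∈ K, q ^ #(pairsIn t ∪ pairsIn r) := by
    have h2 : ∀ A : Finset (Sym2 V), (#(cliques 3 A) : ℝ) ^ 2
        = ∑ t ∈ K, ∑ r ∈ K, if pairsIn t ∪ pairsIn r ⊆ A then (1 : ℝ) else 0 := by
      intro A
      rw [h, sq, sum_mul_sum]
      refine sum_congr rfl fun t _ ↦ sum_congr rfl fun r _ ↦ ?_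
      by_cases ht : pairsIn t ⊆ A <;> by_cases hr : pairsIn r ⊆ A <;> simp [union_subset_iff, ht, hr]
    simp only [h2]
    rw [bexp_sum]
    refine sum_congr rfl fun t _ ↦ ?_
    rw [bexp_sum]
    refine sum_congr rfl fun r _ ↦ ?_
    rw [← bprob_subset (union_subset (pairsIn_mono (subset_univ t)) (pairsIn_mono (subset_univ r)))]
    unfold bprob
    congr!
  have h3 : ∀ t ∈ K, ∑ r ∈ K, q ^ #(pairsIn t ∪ pairsIn r) - ∑ r ∈ K, q ^ 3 * q ^ 3
      ≤ q ^ 3 + 3 * n * q ^ 5 := by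
    intro t ht
    have ht3 := (mem_powersetCard.1 ht).2
    -- the triangles that share an edge with `t`
    let N : Finset (Finset V) := (t ×ˢ univ).image fun z ↦ insert z.2 (t.erase z.1)
    have hN : (#N : ℝ) ≤ 3 * n := by
      have : #N ≤ 3 * n := card_image_le.trans_eq (by rw [card_product, ht3, card_univ])
      exact_mod_cast this
    rw [← sum_sub_distrib]
    calc ∑ r ∈ K, (q ^ #(pairsIn t ∪ pairsIn r) - q ^ 3 * q ^ 3)
        ≤ ∑ r ∈ K, ((if r = t then q ^ 3 else 0) + if r ∈ N then q ^ 5 else 0) := by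
          refine sum_le_sum fun r hr ↦ ?_
          have hr3 := (mem_powersetCard.1 hr).2
          have hu := card_union_add_card_inter (pairsIn t) (pairsIn r)
          rw [pairsIn_inter, card_pairsIn, card_pairsIn, card_pairsIn, ht3, hr3] at hu
          have hle : #(t ∩ r) ≤ 3 := ht3 ▸ card_le_card inter_subset_left
          have hq : 0 ≤ q ^ 3 * q ^ 3 := by positivity
          have hq5 : 0 ≤ if r ∈ N then q ^ 5 else 0 := by positivity
          have hq3 : 0 ≤ if r = t then q ^ 3 else 0 := by positivity
          obtain hc | hc | hc : #(t ∩ r) < 2 ∨ #(t ∩ r) = 2 ∨ #(t ∩ r) = 3 := by omega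
          · rw [Nat.choose_eq_zero_of_lt hc] at hu
            have : #(pairsIn t ∪ pairsIn r) = 6 := hu
            rw [this, ← pow_add, sub_self]
            positivity
          · have : #(pairsIn t ∪ pairsIn r) = 5 := by
              rw [hc] at hu
              exact Nat.add_right_cancel hu
            have hrN : r ∈ N := by
              obtain ⟨x, hx⟩ := card_eq_one.1 (show #(t \ r) = 1 by
                have := card_sdiff_add_card_inter t r
                omega)
              obtain ⟨y, hy⟩ := card_eq_one.1 (show #(r \ t) = 1 by
                have := card_sdiff_add_card_inter r t
                rw [inter_comm] at this
                omega)
              have hx' : x ∈ t ∧ x ∉ r := mem_sdiff.1 (hx ▸ mem_singleton_self x)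
              refine mem_image.2 ⟨(x, y), mem_product.2 ⟨hx'.1, mem_univ y⟩, ?_⟩
              ext z
              have h1 : z ∈ t \ r ↔ z = x := by rw [hx, mem_singleton]
              have h2 : z ∈ r \ t ↔ z = y := by rw [hy, mem_singleton]
              rw [Finset.mem_sdiff] at h1 h2
              rw [mem_insert, mem_erase]
              tauto
            rw [this, if_pos hrN]
            linarith
          · have h1 : t ∩ r = t := eq_of_subset_of_card_le inter_subset_left (by omega)
            have h2 : r = t := (eq_of_subset_of_card_le (inter_eq_left.1 h1) (by omega)).symm
            have : #(pairsIn t ∪ pairsIn r) = 3 := by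
              rw [hc] at hu
              exact Nat.add_right_cancel hu
            rw [this, if_pos h2]
            linarith
      _ ≤ q ^ 3 + 3 * n * q ^ 5 := by
          rw [sum_add_distrib, sum_ite_eq', if_pos ht, sum_ite_mem, sum_const, nsmul_eq_mul]
          have : (#(K ∩ N) : ℝ) ≤ #N := mod_cast card_le_card inter_subset_right
          gcongr
          linarith
  rw [e1, e2, sq, sum_mul_sum, ← sum_sub_distrib]
  calc ∑ t ∈ K, (∑ r ∈ K, q ^ #(pairsIn t ∪ pairsIn r) - ∑ r ∈ K, q ^ 3 * q ^ 3)
      ≤ ∑ t ∈ K, (q ^ 3 + 3 * n * q ^ 5) := sum_le_sum h3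
    _ = #K * (q ^ 3 + 3 * n * q ^ 5) := by rw [sum_const, nsmul_eq_mul]
    _ ≤ ((n ^ 3 : ℕ) : ℝ) * (q ^ 3 + 3 * n * q ^ 5) := by gcongr
    _ = _ := by push_cast; ring

/-- Chebyshev's inequality for the number of triangles. -/
theorem bprob_not_few_triangles (h0 : 0 ≤ q) (h1 : q ≤ 1) (hn : 0 < Fintype.card V)
    (hq : 120 * ((Fintype.card V : ℝ) ^ 3 * q ^ 3) ≤ Fintype.card V) :
    bprob q (pairsIn (univ : Finset V)) (fun A ↦ Fintype.card V ≤ 60 * #(cliques 3 A))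
      ≤ (120 / Fintype.card V) ^ 2 *
        ((Fintype.card V : ℝ) ^ 3 * q ^ 3 + 3 * (Fintype.card V : ℝ) ^ 4 * q ^ 5) := by
  have hv := variance_card_triangles_le (V := V) h0
  set n := Fintype.card V
  set μ := bexp q (pairsIn (univ : Finset V)) (fun A ↦ (#(cliques 3 A) : ℝ)) with hμ
  have hn' : (0 : ℝ) < n := mod_cast hn
  have hμ' : 120 * μ ≤ n := by
    refine le_trans ?_ hq
    rw [hμ, bexp_card_cliques, show Nat.choose 3 2 = 3 from rfl]
    have : ((n.choose 3 : ℕ) : ℝ) ≤ n ^ 3 := mod_cast Nat.choose_le_pow _ _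
    gcongr
  calc bprob q (pairsIn (univ : Finset V)) (fun A ↦ n ≤ 60 * #(cliques 3 A))
      ≤ bexp q (pairsIn univ) (fun A ↦ (120 / n) ^ 2 * ((#(cliques 3 A) : ℝ) - μ) ^ 2) := by
        refine bprob_le_bexp h0 h1 (fun A _ ↦ by positivity) fun A _ h ↦ ?_
        have h2 : (n : ℝ) ≤ 60 * #(cliques 3 A) := mod_cast h
        rw [← mul_pow]
        refine one_le_pow₀ ?_
        rw [div_mul_eq_mul_div, one_le_div hn']
        linarith
    _ ≤ _ := by
        rw [bexp_const_mul, bexp_sq_sub, ← hμ]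
        refine mul_le_mul_of_nonneg_left ?_ (by positivity)
        linarith

end Quasirandom

section Failure

variable {V : Type*} [DecidableEq V] [Fintype V] {q : ℝ}

/-- The union bound over the five properties of a quasirandom graph. -/
theorem bprob_not_isQuasirandom_le (h0 : 0 ≤ q) (h1 : q ≤ 1) {k : ℕ} {d : ℝ}
    (hk : 112 * (q * k) ≤ d) :
    bprob q (pairsIn (univ : Finset V)) (fun A ↦ ¬ IsQuasirandom d k A)
      ≤ bprob q (pairsIn (univ : Finset V)) (fun A ↦ Fintype.card V ≤ 60 * #(cliques 3 A))
        + (Fintype.card V * Real.exp (d / 2 - 3 / 5 * (q * (Fintype.card V - 1)))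
        + (Fintype.card V * Real.exp (7 / 4 * (q * (Fintype.card V / 20)) - d / 4)
        + (((1 + Real.exp (-(d / 64))) ^ Fintype.card V - 1)
        + 4 ^ Fintype.card V * Real.exp (-(3 / 5 * (q * (k * k))))))) := by
  classical
  let s : Finset (Sym2 V) := pairsIn univ
  let 𝒵 : Finset (Finset V) := univ.filter fun Z ↦ Z.Nonempty ∧ #Z ≤ 2 * k
  let 𝒥 : Finset (Finset V × Finset V) :=
    univ.filter fun z ↦ Disjoint z.1 z.2 ∧ k ≤ #z.1 ∧ k ≤ #z.2
  have b2 : bprob q s (fun A ↦ ∃ v ∈ univ, (#(A ∩ spokes v univ) : ℝ) ≤ d / 2)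
      ≤ Fintype.card V * Real.exp (d / 2 - 3 / 5 * (q * (Fintype.card V - 1))) := by
    refine (bprob_exists_le h0 h1 _ _).trans ?_
    rw [← nsmul_eq_mul, ← card_univ]
    exact sum_le_card_nsmul _ _ _ fun v _ ↦ bprob_not_degree h0 h1 v _
  have b3 : bprob q s (fun A ↦ ∃ v ∈ univ,
      20 * #(triangleVerts (A \ spokes v univ)) ≤ Fintype.card V ∧
        d / 4 ≤ #(A ∩ spokes v (triangleVerts (A \ spokes v univ))))
      ≤ Fintype.card V * Real.exp (7 / 4 * (q * (Fintype.card V / 20)) - d / 4) := by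
    refine (bprob_exists_le h0 h1 _ _).trans ?_
    rw [← nsmul_eq_mul, ← card_univ]
    exact sum_le_card_nsmul _ _ _ fun v _ ↦ bprob_not_few_spokes h0 h1 v _
  have b4 : bprob q s (fun A ↦ ∃ Z ∈ 𝒵, #Z * (d / 8) ≤ 4 * (#(A ∩ pairsIn Z) : ℝ))
      ≤ (1 + Real.exp (-(d / 64))) ^ Fintype.card V - 1 := by
    refine (bprob_exists_le h0 h1 _ _).trans ?_
    refine (sum_le_sum fun Z hZ ↦ bprob_not_sparse h0 h1 hk Z (mem_filter.1 hZ).2.2).trans ?_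
    have h2 : ∑ Z : Finset V, Real.exp (-(d / 64)) ^ #Z
        = (1 + Real.exp (-(d / 64))) ^ Fintype.card V := by
      have := sum_pow_mul_eq_add_pow (Real.exp (-(d / 64))) 1 (univ : Finset V)
      simpa [add_comm] using this
    have h3 := sum_erase_eq_sub (f := fun Z : Finset V ↦ Real.exp (-(d / 64)) ^ #Z)
      (mem_univ ∅)
    rw [h2, card_empty, pow_zero] at h3
    rw [← h3]
    refine sum_le_sum_of_subset_of_nonneg (fun Z hZ ↦ ?_) fun _ _ _ ↦ by positivity
    exact mem_erase.2 ⟨(mem_filter.1 hZ).2.1.ne_empty, mem_univ _⟩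
  have b5 : bprob q s (fun A ↦ ∃ z ∈ 𝒥, ¬ ∃ x ∈ z.1, ∃ y ∈ z.2, s(x, y) ∈ A)
      ≤ 4 ^ Fintype.card V * Real.exp (-(3 / 5 * (q * (k * k)))) := by
    refine (bprob_exists_le h0 h1 _ _).trans ?_
    refine (sum_le_card_nsmul 𝒥 _ (Real.exp (-(3 / 5 * (q * (k * k))))) fun z hz ↦ ?_).trans ?_
    · have h2 := (mem_filter.1 hz).2
      exact bprob_not_joined h0 h1 z.1 z.2 h2.1 h2.2.1 h2.2.2
    · rw [nsmul_eq_mul]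
      have h2 : #𝒥 ≤ 4 ^ Fintype.card V := by
        refine (card_le_univ _).trans_eq ?_
        rw [Fintype.card_prod, Fintype.card_finset, ← mul_pow]
        norm_num
      have h3 : (#𝒥 : ℝ) ≤ 4 ^ Fintype.card V := mod_cast h2
      gcongr
  refine le_trans (bprob_mono h0 h1 (Q := fun A ↦ Fintype.card V ≤ 60 * #(cliques 3 A) ∨
      (∃ v ∈ univ, (#(A ∩ spokes v univ) : ℝ) ≤ d / 2) ∨
      (∃ v ∈ univ, 20 * #(triangleVerts (A \ spokes v univ)) ≤ Fintype.card V ∧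
        d / 4 ≤ #(A ∩ spokes v (triangleVerts (A \ spokes v univ)))) ∨
      (∃ Z ∈ 𝒵, #Z * (d / 8) ≤ 4 * (#(A ∩ pairsIn Z) : ℝ)) ∨
      (∃ z ∈ 𝒥, ¬ ∃ x ∈ z.1, ∃ y ∈ z.2, s(x, y) ∈ A)) fun A _ hA ↦ ?_) ?_
  · by_contra! h
    refine hA ⟨h.1.le, fun v ↦ h.2.1 v (mem_univ v), fun v hv ↦ h.2.2.1 v (mem_univ v) hv,
      fun Z hZ hZk ↦ h.2.2.2.1 Z (mem_filter.2 ⟨mem_univ _, hZ, hZk⟩),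
      fun X Y hXY hX hY ↦ h.2.2.2.2 (X, Y) (mem_filter.2 ⟨mem_univ _, hXY, hX, hY⟩)⟩
  · exact (bprob_or_le h0 h1).trans (add_le_add le_rfl <|
      (bprob_or_le h0 h1).trans (add_le_add b2 <|
      (bprob_or_le h0 h1).trans (add_le_add b3 <|
      (bprob_or_le h0 h1).trans (add_le_add b4 b5))))

/-- For `log n ≪ d ≪ n ^ (1 / 3)`, where `n` is the number of vertices and `d = n * q`, the failure
probability is at most `1 / n`. This is small enough for the expectation of the chromatic number,
which is at most `n` when quasirandomness fails. -/
theorem card_mul_bprob_not_isQuasirandom_le_one (h0 : 0 ≤ q) (h1 : q ≤ 1)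
    {n : ℕ} (hn : Fintype.card V = n) {d : ℝ} (hd : d = n * q) (hn0 : 400000 ≤ n)
    (hd0 : 400000 ≤ d) (hlog : 256 * Real.log n ≤ d) (hd3 : 1000000 * d ^ 3 ≤ n) :
    n * bprob q (pairsIn (univ : Finset V)) (fun A ↦ ¬ IsQuasirandom d (n / 112) A) ≤ 1 := by
  set k := n / 112 with hk
  have hn1 : (400000 : ℝ) ≤ n := mod_cast hn0
  have hkle : (112 * k : ℝ) ≤ n := by exact_mod_cast Nat.mul_div_le n 112
  have hkge : (n : ℝ) ≤ 224 * k := by exact_mod_cast (by omega : n ≤ 224 * k)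
  have hbound := bprob_not_isQuasirandom_le (V := V) h0 h1 (k := k) (d := d) (by
    rw [hd]; nlinarith)
  rw [hn] at hbound
  set y := Real.exp (-(d / 64)) with hy
  have hy0 : 0 < y := Real.exp_pos _
  have hny : (n : ℝ) ^ 4 * y ≤ 1 := by
    rw [← Real.exp_log (show (0 : ℝ) < n by linarith), ← Real.exp_nat_mul, hy, ← Real.exp_add]
    refine Real.exp_le_one_iff.2 ?_
    push_cast
    linarith
  -- The variance of the number of triangles is `O(d ^ 3)`, so Chebyshev's inequality gives a failure
  -- probability of order `d ^ 3 / n ^ 2`.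
  have t1 : n * bprob q (pairsIn (univ : Finset V)) (fun A ↦ n ≤ 60 * #(cliques 3 A)) ≤ 1 / 10 := by
    have e : (n : ℝ) ^ 3 * q ^ 3 = d ^ 3 := by rw [hd]; ring
    have h2 := bprob_not_few_triangles (V := V) h0 h1 (by omega) (by
      rw [hn, e]
      have : 0 ≤ d ^ 3 := by positivity
      linarith)
    rw [hn, e] at h2
    have h3 : (n : ℝ) ^ 4 * q ^ 5 ≤ d ^ 3 := by
      have h4 : (n : ℝ) ^ 4 * q ^ 5 * n = d ^ 3 * d ^ 2 := by rw [hd]; ring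
      have h5 : d ^ 2 ≤ n := by nlinarith [sq_nonneg d]
      have h6 : d ^ 3 * d ^ 2 ≤ d ^ 3 * n := by gcongr
      rw [← h4] at h6
      exact le_of_mul_le_mul_right h6 (by linarith)
    calc n * bprob q (pairsIn (univ : Finset V)) (fun A ↦ n ≤ 60 * #(cliques 3 A))
        ≤ n * ((120 / n) ^ 2 * (d ^ 3 + 3 * (n : ℝ) ^ 4 * q ^ 5)) := by gcongr
      _ ≤ n * ((120 / n) ^ 2 * (n / 250000)) := by gcongr; linarith
      _ ≤ 1 / 10 := by field_simp; norm_num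
  have t2 : Real.exp (d / 2 - 3 / 5 * (q * (n - 1))) ≤ y := by
    rw [hy]
    gcongr
    linarith
  have t3 : Real.exp (7 / 4 * (q * (n / 20)) - d / 4) ≤ y := by
    rw [hy]
    gcongr
    linarith
  have hny1 : n * y ≤ 1 := by
    have h2 : (n : ℝ) ≤ n ^ 4 := le_self_pow₀ (by linarith) (by norm_num)
    nlinarith
  have t4 : (1 + y) ^ n - 1 ≤ 2 * (n * y) := by
    have h2 : (1 + y) ^ n ≤ Real.exp (n * y) := by
      rw [Real.exp_nat_mul]
      gcongr
      linarith [Real.add_one_le_exp y]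
    have h3 := Real.abs_exp_sub_one_le (x := n * y) (by rwa [abs_of_nonneg (by positivity)])
    rw [abs_of_nonneg (show 0 ≤ n * y by positivity)] at h3
    linarith [le_abs_self (Real.exp (n * y) - 1)]
  -- `q * k ^ 2` has order `d * n`, and `d` is large enough to beat the number of pairs of sets.
  have t5 : (4 : ℝ) ^ n * Real.exp (-(3 / 5 * (q * (k * k)))) ≤ y := by
    have h2 : (4 : ℝ) ≤ Real.exp 2 := by
      have := Real.add_one_le_exp (1 : ℝ)
      rw [show (2 : ℝ) = 1 + 1 by norm_num, Real.exp_add]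
      nlinarith
    have h3 : d * n / 100000 ≤ 3 / 5 * (q * (k * k)) := by
      have h4 : (n : ℝ) * n ≤ (224 * k) * (224 * k) := by gcongr
      have h5 : q * (n * n) ≤ q * ((224 * k) * (224 * k)) := by gcongr
      have h6 : d * n = q * (n * n) := by rw [hd]; ring
      have h7 : 0 ≤ q * (k * k) := by positivity
      nlinarith
    calc (4 : ℝ) ^ n * Real.exp (-(3 / 5 * (q * (k * k))))
        ≤ Real.exp 2 ^ n * Real.exp (-(3 / 5 * (q * (k * k)))) := by gcongr
      _ ≤ y := by
        rw [← Real.exp_nat_mul, ← Real.exp_add, hy]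
        gcongr
        nlinarith
  have hn2 : 50 * (n * (n * y)) ≤ 1 := by
    have h2 : 50 * ((n : ℝ) * n) ≤ n ^ 4 := by
      have h3 : (50 : ℝ) ≤ n * n := by nlinarith
      nlinarith [mul_self_nonneg (n : ℝ)]
    nlinarith
  calc n * bprob q (pairsIn (univ : Finset V)) (fun A ↦ ¬ IsQuasirandom d k A)
      ≤ n * (bprob q (pairsIn (univ : Finset V)) (fun A ↦ n ≤ 60 * #(cliques 3 A))
        + (n * y + (n * y + (2 * (n * y) + n * y)))) := by
        gcongr
        refine hbound.trans ?_
        have : y ≤ n * y := by nlinarith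
        exact add_le_add le_rfl (add_le_add (by gcongr) (add_le_add (by gcongr)
          (add_le_add t4 (t5.trans this))))
    _ ≤ 1 := by
        rw [mul_add]
        have : 0 ≤ (n : ℝ) * (n * y) := by positivity
        linarith

end Failure

/-! ### Deviations of the chromatic number -/

section Chromatic

theorem chi_le_of_colorable {n m : ℕ} {G : SimpleGraph (Fin n)} (h : G.Colorable m) :
    chi G ≤ m := by
  unfold chi
  exact_mod_cast ENat.toNat_le_of_le_natCast h.chromaticNumber_le

theorem exists_coloring_chi {n : ℕ} (G : SimpleGraph (Fin n)) :
    ∃ m : ℕ, chi G = m ∧ Nonempty (G.Coloring (Fin m)) :=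
  ⟨_, rfl, SimpleGraph.colorable_chromaticNumber G.colorable_of_fintype⟩

instance SimpleGraph.instMeasurableSingletonClass {V : Type*} [Countable V] :
    MeasurableSingletonClass (SimpleGraph V) where
  measurableSet_singleton G := by
    have h : ({G} : Set (SimpleGraph V)) = SimpleGraph.edgeSet ⁻¹' {G.edgeSet} := by ext; simp
    exact h ▸ SimpleGraph.measurable_edgeSet (measurableSet_singleton _)

/-- The complement of `G(n, p)` is a uniformly random set of pairs of density `1 - p`. -/
theorem integral_binomialRandom {n : ℕ} (p : unitInterval) (f : SimpleGraph (Fin n) → ℝ) :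
    ∫ G, f G ∂(SimpleGraph.binomialRandom (Fin n) p)
      = bexp (1 - p) (pairsIn univ) fun A : Finset (Sym2 (Fin n)) ↦
        f (SimpleGraph.fromEdgeSet (A : Set (Sym2 (Fin n))))ᶜ := by
  classical
  rw [integral_fintype .of_finite]
  unfold bexp
  have hedge : ∀ A ⊆ pairsIn (univ : Finset (Fin n)),
      (SimpleGraph.fromEdgeSet (A : Set (Sym2 (Fin n))))ᶜ.edgeSet
        = ((pairsIn univ \ A : Finset _) : Set (Sym2 (Fin n))) := by
    intro A hA
    ext e
    induction e using Sym2.ind with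
    | h u v =>
      rw [SimpleGraph.mem_edgeSet, SimpleGraph.compl_adj, SimpleGraph.fromEdgeSet_adj, mem_coe,
        mem_coe, Finset.mem_sdiff, mk_mem_pairsIn]
      simp only [mem_univ, true_and]
      tauto
  symm
  refine sum_bij' (fun A _ ↦ (SimpleGraph.fromEdgeSet (A : Set (Sym2 (Fin n))))ᶜ)
    (fun G _ ↦ (Set.toFinite Gᶜ.edgeSet).toFinset) (fun _ _ ↦ mem_univ _) (fun G _ ↦ ?_)
    (fun A hA ↦ ?_) (fun G _ ↦ ?_) fun A hA ↦ ?_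
  · rw [mem_powerset]
    intro e
    induction e using Sym2.ind with
    | h u v =>
      intro he
      rw [Set.Finite.mem_toFinset, SimpleGraph.mem_edgeSet] at he
      exact mk_mem_pairsIn.2 ⟨mem_univ _, mem_univ _, he.ne⟩
  · rw [mem_powerset] at hA
    ext e
    rw [Set.Finite.mem_toFinset, compl_compl]
    induction e using Sym2.ind with
    | h u v =>
      rw [SimpleGraph.mem_edgeSet, SimpleGraph.fromEdgeSet_adj, mem_coe]
      exact ⟨fun h ↦ h.1, fun h ↦ ⟨h, (mk_mem_pairsIn.1 (hA h)).2.2⟩⟩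
  · rw [Set.Finite.coe_toFinset, SimpleGraph.fromEdgeSet_edgeSet, compl_compl]
  · rw [mem_powerset] at hA
    rw [smul_eq_mul]
    congr 1
    rw [measureReal_def, SimpleGraph.binomialRandom_singleton, hedge A hA, Set.ncard_coe_finset,
      Nat.card_fin]
    have h2 : #(pairsIn univ \ A) + #A = n.choose 2 := by
      rw [card_sdiff_add_card_eq_card hA, card_pairsIn, card_univ, Fintype.card_fin]
    rw [show n.choose 2 - #(pairsIn univ \ A) = #A by omega, ENNReal.toReal_mul,
      ENNReal.toReal_pow, ENNReal.toReal_pow, mul_comm]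
    simp

variable {α : Type*} [DecidableEq α] {q : ℝ} {s : Finset α}

/-- Mean absolute deviations of `L¹`-close functions are close. -/
theorem bexp_abs_sub_le (h0 : 0 ≤ q) (h1 : q ≤ 1) (f g : Finset α → ℝ) :
    bexp q s (fun A ↦ |f A - bexp q s f|)
      ≤ 2 * bexp q s (fun A ↦ |f A - g A|) + bexp q s (fun A ↦ |g A - bexp q s g|) := by
  have h2 : |bexp q s g - bexp q s f| ≤ bexp q s (fun A ↦ |f A - g A|) := by
    have h3 : bexp q s (fun A ↦ f A - g A) ≤ bexp q s (fun A ↦ |f A - g A|) :=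
      bexp_mono h0 h1 fun A _ ↦ le_abs_self _
    have h4 : bexp q s (fun A ↦ g A - f A) ≤ bexp q s (fun A ↦ |f A - g A|) :=
      bexp_mono h0 h1 fun A _ ↦ (abs_sub_comm (f A) (g A)).symm ▸ le_abs_self _
    rw [bexp_sub] at h3 h4
    rw [abs_le]
    constructor <;> linarith
  calc bexp q s (fun A ↦ |f A - bexp q s f|)
      ≤ bexp q s (fun A ↦ |f A - g A| + |g A - bexp q s g| + |bexp q s g - bexp q s f|) :=
        bexp_mono h0 h1 fun A _ ↦ by
          calc |f A - bexp q s f|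
              = |(f A - g A) + (g A - bexp q s g) + (bexp q s g - bexp q s f)| := by congr 1; ring
            _ ≤ _ := abs_add_three _ _ _
    _ = bexp q s (fun A ↦ |f A - g A|) + bexp q s (fun A ↦ |g A - bexp q s g|)
        + |bexp q s g - bexp q s f| := by rw [bexp_add, bexp_add, bexp_const]
    _ ≤ _ := by linarith

/-- The packing number has variance at most three times its mean. -/
theorem bexp_abs_packingNumber_sub_le {V : Type*} [DecidableEq V] [Fintype V]
    (h0 : 0 ≤ q) (h1 : q ≤ 1) :
    bexp q (pairsIn (univ : Finset V)) (fun A ↦ |(packingNumber A : ℝ)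
        - bexp q (pairsIn (univ : Finset V)) fun A ↦ (packingNumber A : ℝ)|) ^ 2
      ≤ 3 * ((Fintype.card V : ℝ) ^ 3 * q ^ 3) := by
  set μ := bexp q (pairsIn (univ : Finset V)) fun A ↦ (packingNumber A : ℝ) with hμ
  have h2 : μ ≤ (Fintype.card V : ℝ) ^ 3 * q ^ 3 := by
    calc μ ≤ bexp q (pairsIn (univ : Finset V)) (fun A ↦ (#(cliques 3 A) : ℝ)) :=
          bexp_mono h0 h1 fun A _ ↦ mod_cast packingNumber_le_card_cliques A
      _ ≤ _ := by
          rw [bexp_card_cliques, show Nat.choose 3 2 = 3 from rfl]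
          have : (((Fintype.card V).choose 3 : ℕ) : ℝ) ≤ (Fintype.card V : ℝ) ^ 3 :=
            mod_cast Nat.choose_le_pow _ _
          gcongr
  calc bexp q (pairsIn (univ : Finset V)) (fun A ↦ |(packingNumber A : ℝ) - μ|) ^ 2
      ≤ bexp q (pairsIn (univ : Finset V)) (fun A ↦ ((packingNumber A : ℝ) - μ) ^ 2) := by
        refine (sq_bexp_le h0 h1).trans_eq ?_
        simp only [sq_abs]
    _ = bexp q (pairsIn (univ : Finset V)) (fun A ↦ (packingNumber A : ℝ) ^ 2) - μ ^ 2 := by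
        rw [bexp_sq_sub, ← hμ]; ring
    _ ≤ bexp q (pairsIn (univ : Finset V)) (fun A ↦ 3 * (packingNumber A : ℝ)) :=
        (efron_stein h0 h1).trans (bexp_mono h0 h1 fun A _ ↦ sum_sq_packingNumber_sub_erase_le A)
    _ ≤ _ := by rw [bexp_const_mul]; gcongr

open Classical in
/-- The chromatic number of the complement is `(n - packingNumber A) / 2`, up to a correction for
cliques with four vertices and for the failure of quasirandomness. -/
theorem abs_chi_sub_le {n : ℕ} {A : Finset (Sym2 (Fin n))} (hA : A ⊆ pairsIn univ) {d : ℝ}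
    (hd : 8 ≤ d) {k : ℕ} (hk : 120 * k + 20 < 19 * n) :
    |chi (SimpleGraph.fromEdgeSet (A : Set (Sym2 (Fin n))))ᶜ - (1 / 2) * (n - packingNumber A)|
      ≤ #(cliques 4 A) + 1 / 2 + n * if ¬ IsQuasirandom d k A then 1 else 0 := by
  set G := (SimpleGraph.fromEdgeSet (A : Set (Sym2 (Fin n))))ᶜ
  have h1 : (n : ℝ) ≤ 2 * chi G + packingNumber A + #(cliques 4 A) := by
    obtain ⟨m, hm, ⟨C⟩⟩ := exists_coloring_chi G
    have := card_le_of_coloring_compl C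
    rw [Fintype.card_fin] at this
    rw [hm]
    exact_mod_cast this
  have h2 : (0 : ℝ) ≤ #(cliques 4 A) := by positivity
  have h3 : (3 * packingNumber A : ℝ) ≤ n := by
    have := three_mul_packingNumber_le A
    rw [Fintype.card_fin] at this
    exact_mod_cast this
  have h4 : chi G ≤ n := chi_le_of_colorable (by simpa using G.colorable_of_fintype)
  have h5 : (0 : ℝ) ≤ packingNumber A := by positivity
  rw [abs_le]
  by_cases h : IsQuasirandom d k A
  · obtain ⟨m, hm, hm'⟩ := h.exists_colorable hA hd (by rwa [Fintype.card_fin])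
    rw [Fintype.card_fin] at hm'
    have h6 := chi_le_of_colorable hm
    have h7 : (2 * m + packingNumber A : ℝ) ≤ n + 1 := mod_cast hm'
    rw [if_neg (not_not.2 h)]
    constructor <;> linarith
  · rw [if_pos h]
    constructor <;> linarith

/-- The mean absolute deviation of the chromatic number is `O(d ^ (3 / 2))`. -/
theorem integral_abs_chi_sub_le {n : ℕ} (p : unitInterval) {d : ℝ} (hd : d = n * (1 - p))
    (hn0 : 400000 ≤ n) (hd0 : 400000 ≤ d) (hlog : 256 * Real.log n ≤ d)
    (hd3 : 1000000 * d ^ 3 ≤ n) {r : ℝ} (hr0 : 0 ≤ r) (hr : r ^ 2 = d ^ 3) :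
    ∫ G, |chi G - meanChi n p| ∂(SimpleGraph.binomialRandom (Fin n) p) ≤ 2 * r := by
  classical
  unfold meanChi
  rw [integral_binomialRandom, integral_binomialRandom]
  set q : ℝ := 1 - p with hq
  have h0 : 0 ≤ q := sub_nonneg.2 p.2.2
  have h1 : q ≤ 1 := sub_le_self _ p.2.1
  let g : Finset (Sym2 (Fin n)) → ℝ := fun A ↦ (1 / 2) * (n - packingNumber A)
  refine (bexp_abs_sub_le h0 h1 _ g).trans ?_
  have t1 : bexp q (pairsIn univ) (fun A ↦
      |chi (SimpleGraph.fromEdgeSet (A : Set (Sym2 (Fin n))))ᶜ - g A|) ≤ 5 / 2 := by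
    calc bexp q (pairsIn univ) (fun A ↦
          |chi (SimpleGraph.fromEdgeSet (A : Set (Sym2 (Fin n))))ᶜ - g A|)
        ≤ bexp q (pairsIn (univ : Finset (Fin n))) (fun A ↦ #(cliques 4 A) + 1 / 2
            + n * if ¬ IsQuasirandom d (n / 112) A then 1 else 0) :=
          bexp_mono h0 h1 fun A hA ↦ abs_chi_sub_le hA (by linarith) (by omega)
      _ = n.choose 4 * q ^ 6 + 1 / 2 + n * bprob q (pairsIn (univ : Finset (Fin n)))
            (fun A ↦ ¬ IsQuasirandom d (n / 112) A) := by
          rw [bexp_add, bexp_add, bexp_const, bexp_const_mul, bexp_card_cliques, Fintype.card_fin]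
          unfold bprob
          congr!
      _ ≤ 1 + 1 / 2 + 1 := by
          refine add_le_add (add_le_add ?_ le_rfl) (card_mul_bprob_not_isQuasirandom_le_one h0 h1
            (Fintype.card_fin n) hd hn0 hd0 hlog hd3)
          have h2 : ((n.choose 4 : ℕ) : ℝ) ≤ n ^ 4 := mod_cast Nat.choose_le_pow _ _
          have h3 : (n : ℝ) ^ 4 * q ^ 6 * n ^ 2 = (d ^ 3) ^ 2 := by rw [hd]; ring
          have h4 : (d ^ 3) ^ 2 ≤ 1 * (n : ℝ) ^ 2 := by
            rw [one_mul]
            have : 0 ≤ d ^ 3 := by positivity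
            gcongr
            linarith
          rw [← h3] at h4
          refine le_trans (by gcongr) (le_of_mul_le_mul_right h4 ?_)
          have : 0 < (n : ℝ) := by exact_mod_cast (by omega : 0 < n)
          positivity
      _ = 5 / 2 := by norm_num
  have t2 : bexp q (pairsIn univ) (fun A ↦ |g A - bexp q (pairsIn univ) g|) ≤ r := by
    set μ := bexp q (pairsIn (univ : Finset (Fin n))) fun A ↦ (packingNumber A : ℝ) with hμ
    have e1 : bexp q (pairsIn univ) g = 1 / 2 * (n - μ) := by
      simp only [g]
      rw [bexp_const_mul, bexp_sub, bexp_const]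
    have e2 : ∀ A, |g A - bexp q (pairsIn univ) g| = 1 / 2 * |(packingNumber A : ℝ) - μ| := by
      intro A
      rw [e1, ← mul_sub, abs_mul, abs_of_pos (by norm_num : (0 : ℝ) < 1 / 2), abs_sub_comm]
      congr 2
      ring
    simp only [e2]
    rw [bexp_const_mul]
    have h2 := bexp_abs_packingNumber_sub_le (V := Fin n) h0 h1
    rw [Fintype.card_fin, ← mul_pow, ← hd, ← hr, ← hμ] at h2
    have h3 := sq_le_sq₀ (bexp_nonneg h0 h1 fun A _ ↦ abs_nonneg _) (by linarith) |>.1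
      (h2.trans (by nlinarith : 3 * r ^ 2 ≤ (2 * r) ^ 2))
    linarith
  have t3 : 5 ≤ r := by
    by_contra! h
    have : d ≤ d ^ 3 := le_self_pow₀ (by linarith) (by norm_num)
    nlinarith
  linarith

end Chromatic

theorem mainTheorem2 (ε : ℝ) (hε : 0 < ε) :
    ∃ C : ℝ, 0 < C ∧
      ∀ p : ℕ → unitInterval,
        (fun n : ℕ => (n : ℝ)⁻¹ * Real.log n) =o[atTop] (fun n : ℕ => 1 - (p n : ℝ)) →
        (fun n : ℕ => 1 - (p n : ℝ)) =o[atTop] (fun n : ℕ => (n : ℝ) ^ (-(2 / 3) : ℝ)) →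
        ∀ᶠ n : ℕ in atTop,
          (SimpleGraph.binomialRandom (Fin n) (p n)).real
            {G | C * (n : ℝ) ^ (3 / 2 : ℝ) * (1 - (p n : ℝ)) ^ (3 / 2 : ℝ)
                ≤ |chi G - meanChi n (p n)|} ≤ ε := by
  refine ⟨2 / ε, by positivity, fun p hlow hupp ↦ ?_⟩
  have hlogtop := Real.tendsto_log_atTop.comp (tendsto_natCast_atTop_atTop (R := ℝ))
  filter_upwards [hlow.bound (show (0 : ℝ) < 1 / 256 by norm_num),
    hupp.bound (show (0 : ℝ) < 1 / 100 by norm_num), eventually_ge_atTop 400000,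
    hlogtop.eventually_ge_atTop 400000] with n h1 h2 hn0 hl
  simp only [Function.comp_apply] at hl
  have hn : (0 : ℝ) < n := by exact_mod_cast (by omega : 0 < n)
  set q : ℝ := 1 - p n with hq
  have hq0 : 0 ≤ q := sub_nonneg.2 (p n).2.2
  have hlog : 256 * Real.log n ≤ n * q := by
    rw [Real.norm_of_nonneg (mul_nonneg (by positivity) (by linarith)), Real.norm_of_nonneg hq0,
      inv_mul_le_iff₀ hn] at h1
    linarith
  have hd3 : 1000000 * (n * q) ^ 3 ≤ n := by
    rw [Real.norm_of_nonneg hq0, Real.norm_of_nonneg (by positivity)] at h2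
    have h3 : q ^ 3 ≤ (1 / 100 * (n : ℝ) ^ (-(2 / 3) : ℝ)) ^ 3 := by gcongr
    have h4 : ((n : ℝ) ^ (-(2 / 3) : ℝ)) ^ 3 = ((n : ℝ) ^ 2)⁻¹ := by
      rw [← Real.rpow_natCast, ← Real.rpow_mul hn.le, ← Real.rpow_natCast, ← Real.rpow_neg hn.le]
      norm_num
    rw [mul_pow, h4] at h3
    calc 1000000 * (n * q) ^ 3 = 1000000 * n ^ 3 * q ^ 3 := by ring
      _ ≤ 1000000 * n ^ 3 * ((1 / 100) ^ 3 * ((n : ℝ) ^ 2)⁻¹) := by gcongr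
      _ = n := by field_simp; norm_num
  have hd0 : 400000 ≤ n * q := by linarith
  set r : ℝ := (n : ℝ) ^ (3 / 2 : ℝ) * q ^ (3 / 2 : ℝ) with hr
  have hrd : r = (n * q) ^ (3 / 2 : ℝ) := by rw [hr, Real.mul_rpow hn.le hq0]
  have hr0 : 0 < r := hrd ▸ Real.rpow_pos_of_pos (by linarith) _
  have hr2 : r ^ 2 = (n * q) ^ 3 := by
    rw [hrd, ← Real.rpow_natCast, ← Real.rpow_mul (by linarith), ← Real.rpow_natCast]
    norm_num
  have hint := integral_abs_chi_sub_le (p n) rfl hn0 hd0 hlog hd3 hr0.le hr2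
  have hmarkov := mul_meas_ge_le_integral_of_nonneg
    (μ := SimpleGraph.binomialRandom (Fin n) (p n)) (f := fun G ↦ |chi G - meanChi n (p n)|)
    (.of_forall fun G ↦ abs_nonneg _) .of_finite (2 / ε * r)
  have h3 : 2 / ε * r * ε = 2 * r := by field_simp
  rw [mul_assoc, ← hr]
  exact le_of_mul_le_mul_left ((hmarkov.trans hint).trans_eq h3.symm) (by positivity)
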